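/- Let $\gamma^u_P,\gamma^v_P\in\mathbb R$ for $P\in\{0,1,\infty\}$ satisfy $2\gamma^u_P-\gamma^v_P>-1$ and $2\gamma^v_P-\gamma^u_P>-1$ for $P=0,1$, and $2\gamma^u_\infty-\gamma^v_\infty>1$ and $2\gamma^v_\infty-\gamma^u_\infty>1$. Let $(u,v)$ be a real-valued solution of the $SU(3)$ Toda system with singular sources on $\mathbb R^2\cong\mathbb C$, $z=x_1+ix_2$: $$\Delta u+4e^{2u-v}=4\pi(\gamma^u_0\delta_0+\gamma^u_1\delta_1),\qquad \Delta v+4e^{2v-u}=4\pi(\gamma^v_0\delta_0+\gamma^v_1\delta_1),$$ $$u(z)=-2\gamma^u_\infty\log|z|+O(1),\qquad v(z)=-2\gamma^v_\infty\log|z|+O(1)\qquad\text{near }\infty,$$ where $u,v$ are smooth on $\mathbb C\setminus\{0,1\}$, the functions $u,v,e^{2u-v},e^{2v-u}$ are locally integrable on $\mathbb C$, the two equations hold in the sense of distributions on $\mathbb C$, and $\delta_P$ is the Dirac measure at $P$. Put $\partial_z=\frac12(\partial_{x_1}-i\partial_{x_2})$. Suppose that $u(x_1,x_2)=u(x_1,-x_2)$.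 Then there are unique constants $A,B,C,D,E,F,G\in\mathbb C$ such that, as differential operators on $C^\infty(\mathbb C\setminus\{0,1\};\mathbb C)$, $$(\partial_z-v_z)(\partial_z+v_z-u_z)(\partial_z+u_z) =\partial_z^3+\Big(\frac{A}{z^2}+\frac{B}{z(z-1)}+\frac{C}{(z-1)^2}\Big)\partial_z +\Big(\frac{D}{z^3}+\frac{E}{z^2(z-1)}+\frac{F}{z(z-1)^2}+\frac{G}{(z-1)^3}\Big),$$ and the coefficients $E$ and $F$ are real. -/

import Mathlib

open scoped ContDiff Laplacian

namespace SU3Toda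

noncomputable section

/-- `u` solves `Δ u + 4 e ^ h = 4 π (γ₀ δ₀ + γ₁ δ₁)` on the plane in the sense of distributions,
where `δ₀`, `δ₁` are the Dirac measures at the points `0` and `1`. -/
structure SolvesWithSources (γ₀ γ₁ : ℝ) (u h : ℂ → ℝ) : Prop where
  locallyIntegrable : MeasureTheory.LocallyIntegrable u
  locallyIntegrable_exp : MeasureTheory.LocallyIntegrable fun z => Real.exp (h z)
  weak_eq : ∀ φ : ℂ → ℝ, ContDiff ℝ ∞ φ → HasCompactSupport φ →
    (∫ z, u z * (Δ φ) z) + (∫ z, 4 * Real.exp (h z) * φ z)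
      = 4 * Real.pi * (γ₀ * φ 0 + γ₁ * φ 1)

/-- `u (z) = -2 γ log |z| + O(1)` near infinity. -/
def LogAsymptoticAtInfinity (γ : ℝ) (u : ℂ → ℝ) : Prop :=
  (fun z => u z - (-2 * γ * Real.log ‖z‖)) =O[Bornology.cobounded ℂ] fun _ => (1 : ℝ)

/-- The pair `(u, v)` solves the `SU(3)` Toda system with singular sources at `0`, `1`, `∞`, of
strengths `γu P` for `u` and `γv P` for `v` at these three points (`P = 0, 1, 2` respectively).
The values of `u` and `v` at the two points `0` and `1` play no role. -/
structure IsSolution (γu γv : Fin 3 → ℝ) (u v : ℂ → ℝ) : Prop where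
  smooth_u : ContDiffOn ℝ ∞ u {0, 1}ᶜ
  smooth_v : ContDiffOn ℝ ∞ v {0, 1}ᶜ
  eq_u : SolvesWithSources (γu 0) (γu 1) u fun z => 2 * u z - v z
  eq_v : SolvesWithSources (γv 0) (γv 1) v fun z => 2 * v z - u z
  infinity_u : LogAsymptoticAtInfinity (γu 2) u
  infinity_v : LogAsymptoticAtInfinity (γv 2) v

/-- The Wirtinger derivative `∂_z = (∂_{x₁} - i ∂_{x₂}) / 2`. -/
def dz (f : ℂ → ℂ) (z : ℂ) : ℂ :=
  (1 / 2) * (fderiv ℝ f z 1 - Complex.I * fderiv ℝ f z Complex.I)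

/-- The first-order operator `∂_z + a`. -/
def dzAdd (a : ℂ → ℂ) (y : ℂ → ℂ) (z : ℂ) : ℂ := dz y z + a z * y z

/-- The derivative `u_z` of a real-valued function. -/
def dzReal (u : ℂ → ℝ) : ℂ → ℂ := dz fun z => (u z : ℂ)

/-- The operator `(∂_z - v_z) (∂_z + v_z - u_z) (∂_z + u_z)`. -/
def todaOperator (u v : ℂ → ℝ) (y : ℂ → ℂ) : ℂ → ℂ :=
  dzAdd (fun z => -dzReal v z)
    (dzAdd (fun z => dzReal v z - dzReal u z)
      (dzAdd (fun z => dzReal u z) y))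

/-- Seven complex constants `A, …, G`. -/
structure Coefficients where
  (A B C D E F G : ℂ)

/-- The operator `∂_z³ + W₂ ∂_z + W₃`, with
`W₂ = A / z² + B / (z (z - 1)) + C / (z - 1)²` and
`W₃ = D / z³ + E / (z² (z - 1)) + F / (z (z - 1)²) + G / (z - 1)³`. -/
def Coefficients.operator (c : Coefficients) (y : ℂ → ℂ) (z : ℂ) : ℂ :=
  dz (dz (dz y)) z
    + (c.A / z ^ 2 + c.B / (z * (z - 1)) + c.C / (z - 1) ^ 2) * dz y z
    + (c.D / z ^ 3 + c.E / (z ^ 2 * (z - 1)) + c.F / (z * (z - 1) ^ 2)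
        + c.G / (z - 1) ^ 3) * y z

/-- The constants `c` are those of the operator associated with `(u, v)`: the equality
`(∂_z - v_z) (∂_z + v_z - u_z) (∂_z + u_z) = ∂_z³ + W₂ ∂_z + W₃` of differential operators on the
smooth functions on `ℂ ∖ {0, 1}`. -/
def Coefficients.Represents (c : Coefficients) (u v : ℂ → ℝ) : Prop :=
  ∀ y : ℂ → ℂ, ContDiffOn ℝ ∞ y {0, 1}ᶜ →
    ∀ z : ℂ, z ≠ 0 → z ≠ 1 → todaOperator u v y z = c.operator y z

end

end SU3Toda

/-! Expanding the product of first-order operators gives `∂_z³ + W2 ∂_z + W3`, where `W2` and `W3`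
are differential polynomials in `u_z`, `v_z`. Off the sources the Toda equations say `∂_z̄ u_z =
-exp (2u - v)` and `∂_z̄ v_z = -exp (2v - u)`, and with these `∂_z̄ W2 = ∂_z̄ W3 = 0`
(`differentiableOn_W2`, `differentiableOn_W3`). It remains to control two holomorphic functions on
`ℂ ∖ {0, 1}`. If `W2`, `W3` have poles of order at most 2, 3 at `0` and `1`, and vanish to order at
least 2, 3 at infinity, then `(z (z - 1)) ^ k W_k` is a polynomial of degree at most `k`, and its
coordinates in the basis `z ^ j (z - 1) ^ (k - j)` are the seven constants.

Since the order of an isolated singularity is an integer, growth bounds that lose less than one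
power of the distance are enough. They are obtained as follows near a source `P`. The function `F =
exp (2u - v)` satisfies `ΔF ≥ -8F²` and is integrable, so ε-regularity (`exists_epsilon_regularity`)
gives `F ≤ C / |z - P|²`. Testing the weak equation against a truncated logarithm then gives `|u| ≤
C (1 - log |z - P|)` (`exists_abs_le_log`). At infinity the corresponding bounds come from the
prescribed asymptotics. An interior gradient estimate (`abs_pd_le`), iterated on discs of radius
proportional to the distance to `P` (to the origin, at infinity), turns these into bounds on the
derivatives of `u`, `v`, hence on `W2`, `W3` (`norm_W_le`). The logarithms are absorbed into powers
of `m`, where `m ^ 4` is the distance; `exists_sum_eq` combines removable singularities with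
Liouville's theorem.

For the reality statement, the equation for `u` expresses `v` through `u` and `Δu`, so `v` inherits
the reflection symmetry. Then `W2` and `W3` commute with conjugation, the conjugate constants
represent the same operator, and uniqueness makes all the constants real. -/

namespace SU3Toda

open MeasureTheory Metric Set Filter Topology

/-! ### Directional derivatives and the Laplacian. -/

section Operators

variable {E : Type*} [NormedAddCommGroup E] [NormedSpace ℝ E]

/-- The derivative of `f` in the direction `v`. -/
noncomputable def pd (v : ℂ) (f : ℂ → E) (z : ℂ) : E := fderiv ℝ f z v

theorem _root_.ContDiffOn.pd {f : ℂ → E} {U : Set ℂ} (hf : ContDiffOn ℝ ∞ f U) (hU : IsOpen U) (v : ℂ) :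
    ContDiffOn ℝ ∞ (SU3Toda.pd v f) U :=
  (hf.fderiv_of_isOpen hU (by simp)).clm_apply contDiffOn_const

theorem _root_.ContDiffOn.diffAt {f : ℂ → E} {U : Set ℂ} (hf : ContDiffOn ℝ ∞ f U) (hU : IsOpen U)
    {z : ℂ} (hz : z ∈ U) : DifferentiableAt ℝ f z :=
  (hf.contDiffAt (hU.mem_nhds hz)).differentiableAt (by simp)

theorem pd_congr {f g : ℂ → E} {U : Set ℂ} (hU : IsOpen U) (h : EqOn f g U) (v : ℂ) :
    EqOn (pd v f) (pd v g) U := fun z hz => by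
  simp only [pd]
  rw [(h.eventuallyEq_of_mem (hU.mem_nhds hz)).fderiv_eq]

theorem pd_pd_eq {f : ℂ → E} {U : Set ℂ} (hf : ContDiffOn ℝ ∞ f U) (hU : IsOpen U) {z : ℂ}
    (hz : z ∈ U) (v w : ℂ) : pd v (pd w f) z = fderiv ℝ (fderiv ℝ f) z v w := by
  have h := ((hf.fderiv_of_isOpen hU (m := ∞) (by simp)).contDiffAt
    (hU.mem_nhds hz)).differentiableAt (by simp)
  change fderiv ℝ (fun y => fderiv ℝ f y w) z v = _
  rw [fderiv_clm_apply h (differentiableAt_const _)]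
  simp

theorem pd_comm {f : ℂ → E} {U : Set ℂ} (hf : ContDiffOn ℝ ∞ f U) (hU : IsOpen U) {z : ℂ}
    (hz : z ∈ U) (v w : ℂ) : pd v (pd w f) z = pd w (pd v f) z := by
  rw [pd_pd_eq hf hU hz, pd_pd_eq hf hU hz]
  have := (hf.contDiffAt (hU.mem_nhds hz)).isSymmSndFDerivAt
    (by simpa using ENat.LEInfty.out)
  exact this.eq v w

theorem laplacian_eq_pd {f : ℂ → E} {U : Set ℂ} (hf : ContDiffOn ℝ ∞ f U) (hU : IsOpen U) {z : ℂ}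
    (hz : z ∈ U) : (Δ f) z = pd 1 (pd 1 f) z + pd Complex.I (pd Complex.I f) z := by
  rw [pd_pd_eq hf hU hz, pd_pd_eq hf hU hz, InnerProductSpace.laplacian_eq_iteratedFDeriv_complexPlane]
  simp [iteratedFDeriv_two_apply]

theorem continuousOn_laplacian {f : ℂ → E} {U : Set ℂ} (hf : ContDiffOn ℝ ∞ f U) (hU : IsOpen U) :
    ContinuousOn (Δ f) U :=
  (((hf.pd hU 1).pd hU 1).continuousOn.add
    ((hf.pd hU Complex.I).pd hU Complex.I).continuousOn).congr fun _ hz => laplacian_eq_pd hf hU hz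

theorem hasDerivAt_line {f : ℂ → E} {U : Set ℂ} (hf : ContDiffOn ℝ ∞ f U) (hU : IsOpen U)
    (a v : ℂ) {t : ℝ} (ht : a + t • v ∈ U) :
    HasDerivAt (fun t : ℝ => f (a + t • v)) (pd v f (a + t • v)) t := by
  have h := (hf.diffAt hU ht).hasFDerivAt
  have h2 : HasDerivAt (fun t : ℝ => a + t • v) v t := by
    simpa using ((hasDerivAt_id t).smul_const v).const_add a
  exact h.comp_hasDerivAt t h2

end Operators

/-! ### Interior gradient estimate by a barrier. -/

section MaximumPrinciple

/-- A positive second derivative would make `x` a local minimum as well, so `f` would be locally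
constant and `f''` would vanish. -/
theorem second_deriv_nonpos_of_isLocalMax {f f' : ℝ → ℝ} {f'' x : ℝ} (hx : IsLocalMax f x)
    (h1 : ∀ᶠ t in 𝓝 x, HasDerivAt f (f' t) t) (h2 : HasDerivAt f' f'' x) : f'' ≤ 0 := by
  by_contra! h
  have e1 : deriv f =ᶠ[𝓝 x] f' := h1.mono fun t ht => ht.deriv
  have e2 : deriv (deriv f) x = f'' := by rw [e1.deriv_eq, h2.deriv]
  have e3 := isLocalMin_of_deriv_deriv_pos (by rw [e2]; exact h) hx.deriv_eq_zero
    h1.self_of_nhds.continuousAt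
  have e4 : f =ᶠ[𝓝 x] fun _ => f x := by
    filter_upwards [hx, e3] with t a b using le_antisymm a b
  have e5 : deriv f =ᶠ[𝓝 x] fun _ => 0 := by
    filter_upwards [e4.eventuallyEq_nhds] with t ht
    rw [ht.deriv_eq]; simp
  rw [e5.deriv_eq] at e2
  simp at e2
  linarith

variable {w : ℂ → ℝ} {z₀ e e' : ℂ} {s M N : ℝ}

/-- The comparison function of the gradient estimate dominates the odd part of `w`. -/
theorem odd_part_le (hs : 0 < s) (hw : ContDiffOn ℝ ∞ w (ball z₀ s)) (he : ‖e‖ = 1) (he' : ‖e'‖ = 1)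
    (hM : ∀ z ∈ ball z₀ s, |w z| ≤ M)
    (hN : ∀ z ∈ ball z₀ s, |pd e (pd e w) z + pd e' (pd e' w) z| < N)
    {y : ℝ} (hy : y ∈ Icc 0 (s / 3)) :
    (w (z₀ + y • e) - w (z₀ + (-y) • e)) / 2 ≤
      M / (s / 3) ^ 2 * (y * (2 * (s / 3) - y)) + N / 2 * (y * (s / 3 - y)) := by
  -- With `d = s / 3` the points with coordinates `|x|, |y| ≤ d` satisfy `|x| + |y| ≤ 2d < s`, so
  -- they lie in the disc even though `e`, `e'` are only known to be unit vectors.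
  set d := s / 3 with hd
  have hd0 : 0 < d := by positivity
  have hsd : s = 3 * d := by rw [hd]; ring
  have hM0 : 0 ≤ M := (abs_nonneg _).trans (hM z₀ (mem_ball_self hs))
  have hN0 : 0 < N := (abs_nonneg _).trans_lt (hN z₀ (mem_ball_self hs))
  have hmem : ∀ x y : ℝ, |x| ≤ d → |y| ≤ d → z₀ + x • e' + y • e ∈ ball z₀ s := by
    intro x y hx hy
    rw [mem_ball, dist_eq_norm, show z₀ + x • e' + y • e - z₀ = x • e' + y • e by ring]
    refine (norm_add_le _ _).trans_lt ?_
    rw [norm_smul, norm_smul, he, he', Real.norm_eq_abs, Real.norm_eq_abs]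
    linarith
  -- The barrier: the `M` part is harmonic in `(x, y)` and the `N` part has Laplacian `-N`. It is at
  -- least `M` on the sides `x = ±d`, `y = d`, and nonnegative on `y = 0`.
  set φ : ℝ → ℝ → ℝ := fun x y =>
    M / d ^ 2 * (x ^ 2 + y * (2 * d - y)) + N / 2 * (y * (d - y)) with hφ
  set H : ℝ × ℝ → ℝ := fun p =>
    (w (z₀ + p.1 • e' + p.2 • e) - w (z₀ + p.1 • e' + (-p.2) • e)) / 2 - φ p.1 p.2 with hH
  set K : Set (ℝ × ℝ) := Icc (-d) d ×ˢ Icc 0 d with hK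
  have hKc : IsCompact K := isCompact_Icc.prod isCompact_Icc
  have hcont : ContinuousOn H K := by
    have h1 : ContinuousOn (fun p : ℝ × ℝ => w (z₀ + p.1 • e' + p.2 • e)) K := by
      refine hw.continuousOn.comp (by fun_prop) ?_
      rintro ⟨x, y⟩ ⟨hx, hy⟩
      exact hmem x y (abs_le.2 hx) (abs_le.2 ⟨by linarith [hy.1], hy.2⟩)
    have h2 : ContinuousOn (fun p : ℝ × ℝ => w (z₀ + p.1 • e' + (-p.2) • e)) K := by
      refine hw.continuousOn.comp (by fun_prop) ?_
      rintro ⟨x, y⟩ ⟨hx, hy⟩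
      exact hmem x (-y) (abs_le.2 hx) (abs_le.2 ⟨by linarith [hy.2], by linarith [hy.1]⟩)
    have h3 : ContinuousOn (fun p : ℝ × ℝ => φ p.1 p.2) K := by
      apply Continuous.continuousOn; simp only [hφ]; fun_prop
    exact ((h1.sub h2).div_const 2).sub h3
  obtain ⟨⟨x₀, y₀⟩, ⟨hx₀, hy₀⟩, hmax⟩ :=
    hKc.exists_isMaxOn ⟨(0, 0), by constructor <;> simp [hd0.le]⟩ hcont
  suffices hle : H (x₀, y₀) ≤ 0 by
    have := hmax (show ((0 : ℝ), y) ∈ K from ⟨by simp [hd0.le], hy⟩)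
    have h4 : H (0, y) ≤ 0 := le_trans this hle
    simp only [hH, hφ, zero_smul, add_zero] at h4
    nlinarith
  by_contra! hpos
  simp only at hx₀ hy₀
  have hg : (w (z₀ + x₀ • e' + y₀ • e) - w (z₀ + x₀ • e' + (-y₀) • e)) / 2 ≤ M := by
    have a := hM _ (hmem x₀ y₀ (abs_le.2 hx₀) (abs_le.2 ⟨by linarith [hy₀.1], hy₀.2⟩))
    have b := hM _ (hmem x₀ (-y₀) (abs_le.2 hx₀) (abs_le.2 ⟨by linarith [hy₀.2], by linarith [hy₀.1]⟩))
    rw [abs_le] at a b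
    linarith
  have hφM : φ x₀ y₀ < M := by
    simp only [hH] at hpos; linarith
  have hMd : 0 ≤ M / d ^ 2 := by positivity
  have hMd' : M / d ^ 2 * d ^ 2 = M := by field_simp
  have hterm : 0 ≤ y₀ * (d - y₀) := mul_nonneg hy₀.1 (by linarith [hy₀.2])
  -- Where `H > 0`, the barrier is below the odd part and hence below `M`, which excludes three
  -- sides. On `y = 0` the odd part vanishes and `H ≤ 0`. So a positive maximum is interior.
  have hx1 : x₀ ∈ Ioo (-d) d := by
    by_contra hcon
    have : x₀ ^ 2 = d ^ 2 := by
      rcases eq_or_lt_of_le hx₀.1 with h | h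
      · rw [← h]; ring
      · rcases eq_or_lt_of_le hx₀.2 with h' | h'
        · rw [h']
        · exact absurd ⟨h, h'⟩ hcon
    have h5 : d ^ 2 ≤ x₀ ^ 2 + y₀ * (2 * d - y₀) := by nlinarith [hy₀.1]
    have := mul_le_mul_of_nonneg_left h5 hMd
    simp only [hφ] at hφM
    nlinarith
  have hy1 : y₀ ∈ Ioo 0 d := by
    refine ⟨lt_of_le_of_ne hy₀.1 ?_, lt_of_le_of_ne hy₀.2 ?_⟩
    · intro h
      simp only [hH, hφ, ← h] at hpos
      simp at hpos
      nlinarith [mul_nonneg hMd (sq_nonneg x₀)]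
    · intro h
      have h5 : d ^ 2 ≤ x₀ ^ 2 + y₀ * (2 * d - y₀) := by rw [h]; nlinarith [sq_nonneg x₀]
      have := mul_le_mul_of_nonneg_left h5 hMd
      simp only [hφ] at hφM
      nlinarith
  have hlx : IsLocalMax (fun t => H (t, y₀)) x₀ := by
    filter_upwards [Ioo_mem_nhds hx1.1 hx1.2] with t ht
    exact hmax (show (t, y₀) ∈ K from ⟨⟨ht.1.le, ht.2.le⟩, hy₀⟩)
  have hly : IsLocalMax (fun t => H (x₀, t)) y₀ := by
    filter_upwards [Ioo_mem_nhds hy1.1 hy1.2] with t ht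
    exact hmax (show (x₀, t) ∈ K from ⟨hx₀, ⟨ht.1.le, ht.2.le⟩⟩)
  set P := z₀ + x₀ • e' + y₀ • e with hP
  set Q := z₀ + x₀ • e' + (-y₀) • e with hQ
  have hb := isOpen_ball (x := z₀) (ε := s)
  have hw1 := fun v => hw.pd hb v
  have hPm : P ∈ ball z₀ s :=
    hmem x₀ y₀ (abs_le.2 hx₀) (abs_le.2 ⟨by linarith [hy₀.1], hy₀.2⟩)
  have hQm : Q ∈ ball z₀ s :=
    hmem x₀ (-y₀) (abs_le.2 hx₀) (abs_le.2 ⟨by linarith [hy₀.2], by linarith [hy₀.1]⟩)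
  have lx : ∀ f : ℂ → ℝ, ContDiffOn ℝ ∞ f (ball z₀ s) → ∀ t y : ℝ, |t| ≤ d → |y| ≤ d →
      HasDerivAt (fun t : ℝ => f (z₀ + t • e' + y • e)) (pd e' f (z₀ + t • e' + y • e)) t := by
    intro f hf t y ht hy
    have := hasDerivAt_line hf hb (z₀ + y • e) e' (t := t)
      (by convert hmem t y ht hy using 1; ring)
    have hc : ∀ t : ℝ, z₀ + t • e' + y • e = z₀ + y • e + t • e' := fun t => by ring
    simpa only [hc] using this
  have ly : ∀ f : ℂ → ℝ, ContDiffOn ℝ ∞ f (ball z₀ s) → ∀ x t : ℝ, |x| ≤ d → |t| ≤ d →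
      HasDerivAt (fun t : ℝ => f (z₀ + x • e' + t • e)) (pd e f (z₀ + x • e' + t • e)) t := by
    intro f hf x t hx ht
    exact hasDerivAt_line hf hb (z₀ + x • e') e (hmem x t hx ht)
  have ly' : ∀ f : ℂ → ℝ, ContDiffOn ℝ ∞ f (ball z₀ s) → ∀ x t : ℝ, |x| ≤ d → |t| ≤ d →
      HasDerivAt (fun t : ℝ => f (z₀ + x • e' + (-t) • e))
        (-pd e f (z₀ + x • e' + (-t) • e)) t := by
    intro f hf x t hx ht
    have := (ly f hf x (-t) hx (by rwa [abs_neg])).scomp t (hasDerivAt_neg t)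
    simpa [Function.comp_def] using this
  have ax : |x₀| ≤ d := abs_le.2 hx₀
  have ay : |y₀| ≤ d := abs_le.2 ⟨by linarith [hy₀.1], hy₀.2⟩
  have ay' : |-y₀| ≤ d := by rwa [abs_neg]
  have rx := second_deriv_nonpos_of_isLocalMax hlx
    (f' := fun t => (pd e' w (z₀ + t • e' + y₀ • e) - pd e' w (z₀ + t • e' + (-y₀) • e)) / 2
      - M / d ^ 2 * (2 * t))
    (f'' := (pd e' (pd e' w) P - pd e' (pd e' w) Q) / 2 - M / d ^ 2 * 2)
    (by
      filter_upwards [Ioo_mem_nhds hx1.1 hx1.2] with t ht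
      have at' : |t| ≤ d := abs_le.2 ⟨ht.1.le, ht.2.le⟩
      have h1 := (((lx w hw t y₀ at' ay).sub (lx w hw t (-y₀) at' ay')).div_const 2)
      have h2 : HasDerivAt (fun t => φ t y₀) (M / d ^ 2 * (2 * t)) t := by
        simpa [hφ] using (((hasDerivAt_pow 2 t).add_const (y₀ * (2 * d - y₀))).const_mul
          (M / d ^ 2)).add_const (N / 2 * (y₀ * (d - y₀)))
      exact h1.sub h2)
    (by
      have h1 := (((lx _ (hw1 e') x₀ y₀ ax ay).sub (lx _ (hw1 e') x₀ (-y₀) ax ay')).div_const 2)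
      have h2 : HasDerivAt (fun t : ℝ => M / d ^ 2 * (2 * t)) (M / d ^ 2 * 2) x₀ := by
        simpa using ((hasDerivAt_id x₀).const_mul 2).const_mul (M / d ^ 2)
      exact h1.sub h2)
  have ry := second_deriv_nonpos_of_isLocalMax hly
    (f' := fun t => (pd e w (z₀ + x₀ • e' + t • e) - -pd e w (z₀ + x₀ • e' + (-t) • e)) / 2
      - (M / d ^ 2 * (2 * d - 2 * t) + N / 2 * (d - 2 * t)))
    (f'' := (pd e (pd e w) P - - -pd e (pd e w) Q) / 2 - (M / d ^ 2 * (-2) + N / 2 * (-2)))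
    (by
      filter_upwards [Ioo_mem_nhds hy1.1 hy1.2] with t ht
      have at' : |t| ≤ d := abs_le.2 ⟨by linarith [ht.1], ht.2.le⟩
      have h1 := (((ly w hw x₀ t ax at').sub (ly' w hw x₀ t ax at')).div_const 2)
      have h2 : HasDerivAt (fun t => φ x₀ t)
          (M / d ^ 2 * (2 * d - 2 * t) + N / 2 * (d - 2 * t)) t := by
        have a := (hasDerivAt_id' t).mul ((hasDerivAt_id' t).const_sub (2 * d))
        have b := (hasDerivAt_id' t).mul ((hasDerivAt_id' t).const_sub d)
        convert! ((a.const_add (x₀ ^ 2)).const_mul (M / d ^ 2)).add (b.const_mul (N / 2)) using 1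
        ring
      exact h1.sub h2)
    (by
      have h1 := (((ly _ (hw1 e) x₀ y₀ ax ay).sub (ly' _ (hw1 e) x₀ y₀ ax ay).neg).div_const 2)
      have a := ((hasDerivAt_id' y₀).const_mul 2).const_sub (2 * d)
      have b := ((hasDerivAt_id' y₀).const_mul 2).const_sub d
      have h2 := (a.const_mul (M / d ^ 2)).add (b.const_mul (N / 2))
      simp only [mul_one] at h2
      exact h1.sub h2)
  -- Adding `rx` and `ry` cancels the `M` terms and leaves `(L P - L Q) / 2 + N ≤ 0`, with `L` the
  -- sum of the two second derivatives of `w`; this contradicts the strict bound `|L| < N`.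
  have nP := abs_lt.1 (hN P hPm)
  have nQ := abs_lt.1 (hN Q hQm)
  linarith [nP.1, nQ.2]

/-- Both sides of `odd_part_le` vanish at `y = 0`, so their derivatives there are comparable, and
that of the odd part is the derivative of `w` along `e`. -/
theorem pd_le_of_abs_laplacian_lt (hs : 0 < s) (hw : ContDiffOn ℝ ∞ w (ball z₀ s)) (he : ‖e‖ = 1)
    (he' : ‖e'‖ = 1) (hM : ∀ z ∈ ball z₀ s, |w z| ≤ M)
    (hN : ∀ z ∈ ball z₀ s, |pd e (pd e w) z + pd e' (pd e' w) z| < N) :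
    pd e w z₀ ≤ 6 * M / s + N * s := by
  have hM0 : 0 ≤ M := (abs_nonneg _).trans (hM z₀ (mem_ball_self hs))
  have hN0 : 0 < N := (abs_nonneg _).trans_lt (hN z₀ (mem_ball_self hs))
  have hb := isOpen_ball (x := z₀) (ε := s)
  have h0 : z₀ + (0 : ℝ) • e ∈ ball z₀ s := by simp [hs]
  have h1 := hasDerivAt_line hw hb z₀ e h0
  have h2 : HasDerivAt (fun t : ℝ => w (z₀ + (-t) • e)) (-pd e w z₀) 0 := by
    have h1' : HasDerivAt (fun t : ℝ => w (z₀ + t • e)) (pd e w z₀) (-0) := by simpa using h1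
    simpa [Function.comp_def] using h1'.scomp (0 : ℝ) (hasDerivAt_neg 0)
  simp only [zero_smul, add_zero] at h1
  have h3 := (h1.sub h2).div_const 2
  have a := (hasDerivAt_id' (0 : ℝ)).mul ((hasDerivAt_id' (0 : ℝ)).const_sub (2 * (s / 3)))
  have b := (hasDerivAt_id' (0 : ℝ)).mul ((hasDerivAt_id' (0 : ℝ)).const_sub (s / 3))
  have h4 := (((a.const_mul (M / (s / 3) ^ 2)).add (b.const_mul (N / 2)))).sub h3
  have h5 : 0 ≤ M / (s / 3) ^ 2 * (2 * (s / 3)) + N / 2 * (s / 3) - pd e w z₀ := by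
    have h6 := (hasDerivWithinAt_iff_tendsto_slope' (by simp)).1 (h4.hasDerivWithinAt (s := Ioi 0))
    have h7 := ge_of_tendsto (b := 0) h6 (by
      filter_upwards [Ioo_mem_nhdsGT (show (0 : ℝ) < s / 3 by positivity)] with t ht
      rw [slope_def_field]
      refine div_nonneg ?_ (by linarith [ht.1])
      have := odd_part_le hs hw he he' hM hN (y := t) ⟨ht.1.le, ht.2.le⟩
      simp only [Pi.sub_apply, Pi.add_apply, Pi.mul_apply, zero_smul, neg_zero, add_zero, sub_self,
        zero_mul, mul_zero, zero_div, sub_zero]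
      linarith)
    simp at h7
    linarith
  have h8 : M / (s / 3) ^ 2 * (2 * (s / 3)) = 6 * M / s := by field_simp; ring
  have : N / 2 * (s / 3) ≤ N * s := by nlinarith [mul_pos hN0 hs]
  linarith

/-- Interior gradient estimate for the Laplacian. -/
theorem abs_pd_le (hs : 0 < s) (hw : ContDiffOn ℝ ∞ w (ball z₀ s))
    (hM : ∀ z ∈ ball z₀ s, |w z| ≤ M) (hN : ∀ z ∈ ball z₀ s, |(Δ w) z| ≤ N) :
    |pd 1 w z₀| ≤ 6 * M / s + N * s ∧ |pd Complex.I w z₀| ≤ 6 * M / s + N * s := by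
  have hb := isOpen_ball (x := z₀) (ε := s)
  have key : ∀ e e' : ℂ, ‖e‖ = 1 → ‖e'‖ = 1 →
      (∀ z ∈ ball z₀ s, |pd e (pd e w) z + pd e' (pd e' w) z| ≤ N) →
      |pd e w z₀| ≤ 6 * M / s + N * s := by
    intro e e' he he' hN
    -- The barrier argument needs a strict bound on the Laplacian; replacing `N` by `N + ε / s`
    -- costs exactly `ε`.
    refine le_of_forall_pos_le_add fun ε hε => ?_
    have hN1 : ∀ z ∈ ball z₀ s, |pd e (pd e w) z + pd e' (pd e' w) z| < N + ε / s :=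
      fun z hz => (hN z hz).trans_lt (by have := div_pos hε hs; linarith)
    have hw' : ContDiffOn ℝ ∞ (-w) (ball z₀ s) := hw.neg
    have hneg : ∀ v, ∀ f : ℂ → ℝ, pd v (-f) = -pd v f := by
      intro v f; ext z; simp [pd, fderiv_neg]
    have r1 := pd_le_of_abs_laplacian_lt hs hw he he' hM hN1
    have r2 := pd_le_of_abs_laplacian_lt hs hw' he he' (fun z hz => by simpa using hM z hz)
      (fun z hz => by
        simp only [hneg, Pi.neg_apply]
        rw [← neg_add, abs_neg]; exact hN1 z hz)
    simp only [hneg, Pi.neg_apply] at r2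
    have : (N + ε / s) * s = N * s + ε := by field_simp
    rw [abs_le]; constructor <;> linarith
  constructor
  · refine key 1 Complex.I (by simp) (by simp) fun z hz => ?_
    rw [← laplacian_eq_pd hw hb hz]; exact hN z hz
  · refine key Complex.I 1 (by simp) (by simp) fun z hz => ?_
    rw [add_comm, ← laplacian_eq_pd hw hb hz]; exact hN z hz

end MaximumPrinciple

/-! ### Integration by parts against test functions. -/

section IntegrationByParts

theorem tsupport_pd_subset (v : ℂ) (φ : ℂ → ℝ) : tsupport (pd v φ) ⊆ tsupport φ := by
  refine closure_minimal (fun x hx => ?_) (isClosed_tsupport φ)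
  refine tsupport_fderiv_subset ℝ (subset_tsupport _ ?_)
  rw [Function.mem_support] at hx ⊢
  intro h
  exact hx (by simp [pd, h])

theorem _root_.HasCompactSupport.pd {φ : ℂ → ℝ} (hc : HasCompactSupport φ) (v : ℂ) :
    HasCompactSupport (SU3Toda.pd v φ) :=
  hc.of_isClosed_subset (isClosed_tsupport _) (tsupport_pd_subset v φ)

theorem _root_.ContDiff.pd {φ : ℂ → ℝ} (hφ : ContDiff ℝ ∞ φ) (v : ℂ) :
    ContDiff ℝ ∞ (SU3Toda.pd v φ) :=
  contDiffOn_univ.1 (hφ.contDiffOn.pd isOpen_univ v)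

variable {U : Set ℂ} {u φ : ℂ → ℝ}

theorem integrable_mul_of_tsupport_subset (hU : IsOpen U) (hu : ContinuousOn u U)
    (hφ : Continuous φ) (hc : HasCompactSupport φ) (hs : tsupport φ ⊆ U) :
    Integrable fun z => u z * φ z := by
  have h1 : Continuous fun z => u z * φ z :=
    (hu.mul hφ.continuousOn).continuous_of_tsupport_subset hU
      ((tsupport_mul_subset_right).trans hs)
  exact h1.integrable_of_hasCompactSupport hc.mul_left

theorem integral_mul_pd (hU : IsOpen U) (hu : ContDiffOn ℝ ∞ u U) (hφ : ContDiff ℝ ∞ φ)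
    (hc : HasCompactSupport φ) (hs : tsupport φ ⊆ U) (v : ℂ) :
    ∫ z, u z * pd v φ z = -∫ z, pd v u z * φ z :=
  integral_mul_fderiv_eq_neg_fderiv_mul_of_integrable
    (integrable_mul_of_tsupport_subset hU (hu.pd hU v).continuousOn hφ.continuous hc hs)
    (integrable_mul_of_tsupport_subset hU hu.continuousOn (hφ.pd v).continuous (hc.pd v)
      ((tsupport_pd_subset v φ).trans hs))
    (integrable_mul_of_tsupport_subset hU hu.continuousOn hφ.continuous hc hs)
    (fun _ hx => hu.diffAt hU (hs hx)) (fun x _ => hφ.contDiffAt.differentiableAt (by simp))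

theorem integral_mul_pd_pd (hU : IsOpen U) (hu : ContDiffOn ℝ ∞ u U) (hφ : ContDiff ℝ ∞ φ)
    (hc : HasCompactSupport φ) (hs : tsupport φ ⊆ U) (v : ℂ) :
    ∫ z, u z * pd v (pd v φ) z = ∫ z, pd v (pd v u) z * φ z := by
  rw [integral_mul_pd hU hu (hφ.pd v) (hc.pd v) ((tsupport_pd_subset v φ).trans hs),
    integral_mul_pd hU (hu.pd hU v) hφ hc hs, neg_neg]

/-- Green's identity against a test function. -/
theorem integral_mul_laplacian (hU : IsOpen U) (hu : ContDiffOn ℝ ∞ u U) (hφ : ContDiff ℝ ∞ φ)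
    (hc : HasCompactSupport φ) (hs : tsupport φ ⊆ U) :
    ∫ z, u z * (Δ φ) z = ∫ z, (Δ u) z * φ z := by
  have e1 : ∀ z, u z * (Δ φ) z =
      u z * pd 1 (pd 1 φ) z + u z * pd Complex.I (pd Complex.I φ) z := fun z => by
    rw [laplacian_eq_pd hφ.contDiffOn isOpen_univ (mem_univ z), mul_add]
  have e2 : ∀ z, (Δ u) z * φ z =
      pd 1 (pd 1 u) z * φ z + pd Complex.I (pd Complex.I u) z * φ z := fun z => by
    by_cases hz : z ∈ U
    · rw [laplacian_eq_pd hu hU hz, add_mul]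
    · have : φ z = 0 := image_eq_zero_of_notMem_tsupport fun h => hz (hs h)
      simp [this]
  have i1 : ∀ v, Integrable fun z => u z * pd v (pd v φ) z := fun v =>
    integrable_mul_of_tsupport_subset hU hu.continuousOn ((hφ.pd v).pd v).continuous
      ((hc.pd v).pd v)
      (((tsupport_pd_subset v _).trans (tsupport_pd_subset v φ)).trans hs)
  have i2 : ∀ v, Integrable fun z => pd v (pd v u) z * φ z := fun v =>
    integrable_mul_of_tsupport_subset hU ((hu.pd hU v).pd hU v).continuousOn hφ.continuous hc hs
  simp_rw [e1, e2]
  rw [integral_add (i1 _) (i1 _), integral_add (i2 _) (i2 _),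
    integral_mul_pd_pd hU hu hφ hc hs, integral_mul_pd_pd hU hu hφ hc hs]

end IntegrationByParts

/-! ### Radial kernels and a smoothed logarithm. -/

section Kernels

/-- A smooth nonincreasing cutoff, equal to `1` on `(-∞, 1/2]` and to `0` on `[3/4, ∞)`. -/
noncomputable def psi (t : ℝ) : ℝ := Real.smoothTransition (3 - 4 * t)

theorem psi_of_le {t : ℝ} (h : t ≤ 1 / 2) : psi t = 1 :=
  Real.smoothTransition.one_of_one_le (by linarith)

theorem psi_of_ge {t : ℝ} (h : 3 / 4 ≤ t) : psi t = 0 :=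
  Real.smoothTransition.zero_of_nonpos (by linarith)

theorem psi_nonneg (t : ℝ) : 0 ≤ psi t := Real.smoothTransition.nonneg _

theorem psi_le_one (t : ℝ) : psi t ≤ 1 := Real.smoothTransition.le_one _

theorem contDiff_psi : ContDiff ℝ ∞ psi :=
  Real.smoothTransition.contDiff.comp (by fun_prop)

theorem antitone_psi : Antitone psi := fun a b h =>
  Real.smoothTransition.monotone (by linarith)

theorem hasDerivAt_psi (t : ℝ) : HasDerivAt psi (deriv psi t) t :=
  (contDiff_psi.contDiffAt.differentiableAt (by simp)).hasDerivAt

theorem contDiff_deriv_psi : ContDiff ℝ ∞ (deriv psi) :=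
  (contDiff_infty_iff_deriv.1 contDiff_psi).2

theorem deriv_psi_of_gt {t : ℝ} (h : 3 / 4 < t) : deriv psi t = 0 := by
  have : psi =ᶠ[𝓝 t] fun _ => 0 := by
    filter_upwards [lt_mem_nhds h] with x hx using psi_of_ge hx.le
  rw [this.deriv_eq]; simp

/-- The radial bump `ψ(|y|²)`. -/
noncomputable def bump (y : ℂ) : ℝ := psi (‖y‖ ^ 2)

/-- The averaging kernel `-2 ψ'(|y|²)`. -/
noncomputable def avgKernel (y : ℂ) : ℝ := -2 * deriv psi (‖y‖ ^ 2)

theorem contDiff_bump : ContDiff ℝ ∞ bump := contDiff_psi.comp (contDiff_norm_sq ℝ)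

theorem contDiff_avgKernel : ContDiff ℝ ∞ avgKernel :=
  contDiff_const.mul (contDiff_deriv_psi.comp (contDiff_norm_sq ℝ))

theorem bump_nonneg (y : ℂ) : 0 ≤ bump y := psi_nonneg _

theorem avgKernel_nonneg (y : ℂ) : 0 ≤ avgKernel y := by
  have : deriv psi (‖y‖ ^ 2) ≤ 0 := antitone_psi.deriv_nonpos
  unfold avgKernel; linarith

theorem bump_of_one_le {y : ℂ} (h : 1 ≤ ‖y‖) : bump y = 0 := psi_of_ge (by nlinarith)

theorem avgKernel_of_one_le {y : ℂ} (h : 1 ≤ ‖y‖) : avgKernel y = 0 := by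
  rw [avgKernel, deriv_psi_of_gt (by nlinarith), mul_zero]

theorem tsupport_subset_of_one_le {f : ℂ → ℝ} (h : ∀ y, 1 ≤ ‖y‖ → f y = 0) :
    tsupport f ⊆ closedBall 0 1 := by
  refine closure_minimal (fun y hy => ?_) isClosed_closedBall
  rw [mem_closedBall_zero_iff]
  by_contra! hcon
  exact hy (h y hcon.le)

theorem hasCompactSupport_bump : HasCompactSupport bump :=
  (isCompact_closedBall 0 1).of_isClosed_subset (isClosed_tsupport _)
    (tsupport_subset_of_one_le fun _ => bump_of_one_le)

theorem hasCompactSupport_avgKernel : HasCompactSupport avgKernel :=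
  (isCompact_closedBall 0 1).of_isClosed_subset (isClosed_tsupport _)
    (tsupport_subset_of_one_le fun _ => avgKernel_of_one_le)

theorem integrable_bump : Integrable bump :=
  contDiff_bump.continuous.integrable_of_hasCompactSupport hasCompactSupport_bump

theorem integrable_avgKernel : Integrable avgKernel :=
  contDiff_avgKernel.continuous.integrable_of_hasCompactSupport hasCompactSupport_avgKernel

theorem exists_avgKernel_le : ∃ C, 0 < C ∧ ∀ y, avgKernel y ≤ C := by
  obtain ⟨C, hC⟩ := contDiff_avgKernel.continuous.bounded_above_of_compact_support
    hasCompactSupport_avgKernel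
  exact ⟨max C 1, by positivity, fun y => ((le_abs_self _).trans (hC y)).trans (le_max_left _ _)⟩

theorem integral_avgKernel_pos : 0 < ∫ y, avgKernel y := by
  obtain ⟨t, ht, hd⟩ := exists_deriv_eq_slope psi (show (0 : ℝ) < 1 by norm_num)
    contDiff_psi.continuous.continuousOn
    (fun x _ => (hasDerivAt_psi x).differentiableAt.differentiableWithinAt)
  rw [psi_of_ge (by norm_num), psi_of_le (by norm_num)] at hd
  refine contDiff_avgKernel.continuous.integral_pos_of_hasCompactSupport_nonneg_nonzero
    hasCompactSupport_avgKernel avgKernel_nonneg (x := (Real.sqrt t : ℂ)) ?_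
  have h2 : ‖(Real.sqrt t : ℂ)‖ ^ 2 = t := by
    rw [Complex.norm_real, Real.norm_eq_abs, sq_abs, Real.sq_sqrt ht.1.le]
  rw [avgKernel, h2, hd]; norm_num

theorem pd_comp_norm_sq {g : ℝ → ℝ} {g' : ℝ} {y : ℂ} (hg : HasDerivAt g g' (‖y‖ ^ 2)) (v : ℂ) :
    pd v (fun y => g (‖y‖ ^ 2)) y = 2 * g' * inner ℝ y v := by
  have h1 : HasFDerivAt (fun y : ℂ => ‖y‖ ^ 2) (2 • innerSL ℝ y) y :=
    (hasStrictFDerivAt_norm_sq y).hasFDerivAt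
  have := hg.comp_hasFDerivAt y h1
  rw [pd, show (fun y : ℂ => g (‖y‖ ^ 2)) = g ∘ fun y => ‖y‖ ^ 2 from rfl, this.fderiv]
  simp
  ring

theorem pd_bump (v y : ℂ) : pd v bump y = -(avgKernel y * inner ℝ y v) := by
  rw [show bump = fun y => psi (‖y‖ ^ 2) from rfl, pd_comp_norm_sq (hasDerivAt_psi _), avgKernel]
  ring

/-- The function `(1 - ψ(t)) / (2t)`. -/
noncomputable def lamDeriv (t : ℝ) : ℝ := (1 - psi t) / (2 * t)

theorem lamDeriv_of_le {t : ℝ} (h : t ≤ 1 / 2) : lamDeriv t = 0 := by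
  simp [lamDeriv, psi_of_le h]

theorem lamDeriv_nonneg (t : ℝ) : 0 ≤ lamDeriv t := by
  rcases le_total t (1 / 2) with h | h
  · rw [lamDeriv_of_le h]
  · exact div_nonneg (by linarith [psi_le_one t]) (by linarith)

theorem mul_lamDeriv (t : ℝ) : t * lamDeriv t = (1 - psi t) / 2 := by
  rcases le_or_gt t (1 / 2) with h | h
  · rw [lamDeriv_of_le h, psi_of_le h]; simp
  · rw [lamDeriv]; field_simp

/-- The numerator is identically zero for `t ≤ 1 / 2`, so the denominator does no harm at `0`. -/
theorem contDiff_lamDeriv : ContDiff ℝ ∞ lamDeriv := by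
  rw [contDiff_iff_contDiffAt]
  intro t
  rcases lt_or_ge t (1 / 2) with h | h
  · have : lamDeriv =ᶠ[𝓝 t] fun _ => 0 := by
      filter_upwards [gt_mem_nhds h] with x hx using lamDeriv_of_le hx.le
    exact contDiffAt_const.congr_of_eventuallyEq this
  · exact (contDiffAt_const.sub contDiff_psi.contDiffAt).div
      (contDiffAt_const.mul contDiffAt_id) (by simp; linarith)

/-- A smooth function equal to `(log t) / 2` up to a constant on `[3/4, ∞)`. -/
noncomputable def lam (t : ℝ) : ℝ := ∫ τ in (0 : ℝ)..t, lamDeriv τ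

theorem hasDerivAt_lam (t : ℝ) : HasDerivAt lam (lamDeriv t) t :=
  intervalIntegral.integral_hasDerivAt_right
    (contDiff_lamDeriv.continuous.intervalIntegrable _ _)
    contDiff_lamDeriv.continuous.aestronglyMeasurable.stronglyMeasurableAtFilter
    contDiff_lamDeriv.continuous.continuousAt

theorem contDiff_lam : ContDiff ℝ ∞ lam := by
  rw [contDiff_infty_iff_deriv]
  refine ⟨fun t => (hasDerivAt_lam t).differentiableAt, ?_⟩
  rw [show deriv lam = lamDeriv from funext fun t => (hasDerivAt_lam t).deriv]
  exact contDiff_lamDeriv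

theorem monotone_lam : Monotone lam :=
  monotone_of_deriv_nonneg (fun t => (hasDerivAt_lam t).differentiableAt) fun t => by
    rw [(hasDerivAt_lam t).deriv]; exact lamDeriv_nonneg t

theorem lam_zero : lam 0 = 0 := by simp [lam]

theorem lam_of_one_le {t : ℝ} (h : 1 ≤ t) : lam t = lam 1 + Real.log t / 2 := by
  have key : ∀ x ∈ Ici (1 : ℝ), HasDerivWithinAt (fun t => lam t - Real.log t / 2) 0 (Ici 1) x := by
    intro x hx
    have hx' : (1 : ℝ) ≤ x := hx
    have h1 := (hasDerivAt_lam x).sub ((Real.hasDerivAt_log (by positivity)).div_const 2)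
    have h2 : lamDeriv x - x⁻¹ / 2 = 0 := by
      rw [lamDeriv, psi_of_ge (by linarith)]; field_simp; ring
    rw [h2] at h1
    exact h1.hasDerivWithinAt
  have := (convex_Ici (1 : ℝ)).is_const_of_fderivWithin_eq_zero (𝕜 := ℝ)
    (f := fun t => lam t - Real.log t / 2) (fun x hx => (key x hx).differentiableWithinAt)
    (fun x hx => by
      have hu : UniqueDiffWithinAt ℝ (Ici (1 : ℝ)) x := (uniqueDiffOn_Ici 1) x hx
      ext
      exact ((key x hx).derivWithin hu).trans (by simp)) (show (1 : ℝ) ∈ Ici 1 by simp) (show t ∈ Ici 1 from h)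
  simp at this
  linarith

/-- The smoothed logarithmic potential `λ(|y|²)`. -/
noncomputable def logPotential (y : ℂ) : ℝ := lam (‖y‖ ^ 2)

theorem contDiff_logPotential : ContDiff ℝ ∞ logPotential :=
  contDiff_lam.comp (contDiff_norm_sq ℝ)

/-- In the plane the Laplacian of `g (|y|²)` is `4 (t g')'` at `t = |y|²`. For `g = λ` one has `t λ'
= (1 - ψ) / 2`, which leaves `-2ψ'`. -/
theorem laplacian_logPotential (y : ℂ) : (Δ logPotential) y = avgKernel y := by
  rw [laplacian_eq_pd contDiff_logPotential.contDiffOn isOpen_univ (mem_univ y)]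
  have hd : ∀ t, HasDerivAt lamDeriv (deriv lamDeriv t) t := fun t =>
    (contDiff_lamDeriv.contDiffAt.differentiableAt (by simp)).hasDerivAt
  have e1 : ∀ v, pd v logPotential = fun y => 2 * (lamDeriv (‖y‖ ^ 2) * inner ℝ y v) := by
    intro v; ext y
    rw [show logPotential = fun y => lam (‖y‖ ^ 2) from rfl, pd_comp_norm_sq (hasDerivAt_lam _)]
    ring
  have e2 : ∀ v, pd v (pd v logPotential) y =
      4 * deriv lamDeriv (‖y‖ ^ 2) * (inner ℝ y v) ^ 2 + 2 * lamDeriv (‖y‖ ^ 2) * ‖v‖ ^ 2 := by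
    intro v
    rw [e1]
    have h1 : HasFDerivAt (fun y : ℂ => ‖y‖ ^ 2) (2 • innerSL ℝ y) y :=
      (hasStrictFDerivAt_norm_sq y).hasFDerivAt
    have h2 : HasFDerivAt (fun y : ℂ => inner ℝ y v) (innerSL ℝ v) y := by
      have : (fun y : ℂ => inner ℝ y v) = fun y => innerSL ℝ v y := by
        ext y; simp [real_inner_comm]
      rw [this]; exact (innerSL ℝ v).hasFDerivAt
    have h3 := (((hd (‖y‖ ^ 2)).comp_hasFDerivAt y h1).mul h2).const_mul 2
    rw [pd]
    have h4 := h3.fderiv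
    simp only [Function.comp_def] at h4
    erw [h4]
    simp
    ring
  rw [e2, e2]
  -- Differentiating `t λ' = (1 - ψ) / 2` avoids computing `λ''` explicitly.
  have h5 := ((hasDerivAt_id' (‖y‖ ^ 2)).mul (hd (‖y‖ ^ 2))).unique
    (((hasDerivAt_psi (‖y‖ ^ 2)).const_sub 1).div_const 2 |>.congr_of_eventuallyEq
      (Eventually.of_forall fun t => mul_lamDeriv t))
  have h6 : (inner ℝ y 1) ^ 2 + (inner ℝ y Complex.I) ^ 2 = ‖y‖ ^ 2 := by
    rw [Complex.sq_norm, Complex.normSq_apply]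
    simp [Complex.inner]
    ring
  simp only [norm_one, Complex.norm_I, avgKernel]
  linear_combination 4 * h5 + 4 * deriv lamDeriv (‖y‖ ^ 2) * h6

end Kernels

/-! ### Weighted averages over discs and the mean value inequality. -/

section MeanValue

theorem pd_comp_affine {f : ℂ → ℝ} {z₀ y : ℂ} {s : ℝ} (hf : DifferentiableAt ℝ f (z₀ + s • y))
    (v : ℂ) : pd v (fun y => f (z₀ + s • y)) y = s * pd v f (z₀ + s • y) := by
  have h : HasFDerivAt (fun y : ℂ => z₀ + s • y) (s • ContinuousLinearMap.id ℝ ℂ) y :=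
    ((hasFDerivAt_id y).const_smul s).const_add z₀
  have := (hf.hasFDerivAt.comp y h).fderiv
  simp only [Function.comp_def] at this
  rw [pd, this]
  simp [pd]

variable {F : ℂ → ℝ} {z₀ : ℂ} {r s : ℝ}

theorem isOpen_preimage_affine (z₀ : ℂ) (s r : ℝ) : IsOpen {y : ℂ | z₀ + s • y ∈ ball z₀ r} :=
  isOpen_ball.preimage (by fun_prop)

theorem affine_mem_ball {y : ℂ} (hs : |s| < r) (hy : ‖y‖ ≤ 1) : z₀ + s • y ∈ ball z₀ r := by
  rw [mem_ball, dist_eq_norm, add_sub_cancel_left, norm_smul, Real.norm_eq_abs]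
  exact (mul_le_of_le_one_right (abs_nonneg _) hy).trans_lt hs

theorem tsupport_subset_affine {φ : ℂ → ℝ} (hφ : ∀ y, 1 ≤ ‖y‖ → φ y = 0) (hs : |s| < r) :
    tsupport φ ⊆ {y : ℂ | z₀ + s • y ∈ ball z₀ r} := fun y hy =>
  affine_mem_ball hs (by simpa using tsupport_subset_of_one_le hφ hy)

theorem contDiffOn_comp_affine (hF : ContDiffOn ℝ ∞ F (ball z₀ r)) (s : ℝ) :
    ContDiffOn ℝ ∞ (fun y : ℂ => F (z₀ + s • y)) {y : ℂ | z₀ + s • y ∈ ball z₀ r} :=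
  hF.comp (by fun_prop) fun _ hy => hy

theorem continuousOn_comp_affine (hF : ContinuousOn F (ball z₀ r)) (s : ℝ) :
    ContinuousOn (fun y : ℂ => F (z₀ + s • y)) {y : ℂ | z₀ + s • y ∈ ball z₀ r} :=
  hF.comp (by fun_prop) fun _ hy => hy

theorem integrable_comp_affine_mul (hF : ContinuousOn F (ball z₀ r)) (hs : |s| < r) {φ : ℂ → ℝ}
    (hφc : Continuous φ) (hφ : ∀ y, 1 ≤ ‖y‖ → φ y = 0) :
    Integrable fun y : ℂ => F (z₀ + s • y) * φ y :=
  integrable_mul_of_tsupport_subset (isOpen_preimage_affine z₀ s r) (continuousOn_comp_affine hF s)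
    hφc ((isCompact_closedBall 0 1).of_isClosed_subset (isClosed_tsupport _)
      (tsupport_subset_of_one_le hφ)) (tsupport_subset_affine hφ hs)

theorem pd_bump_of_one_le (v : ℂ) {y : ℂ} (hy : 1 ≤ ‖y‖) : pd v bump y = 0 := by
  rw [pd_bump, avgKernel_of_one_le hy]; simp

/-- Derivative of weighted averages over concentric discs with respect to the radius. -/
theorem hasDerivAt_average (hF : ContDiffOn ℝ ∞ F (ball z₀ r)) (hs : |s| < r) :
    HasDerivAt (fun s : ℝ => ∫ y : ℂ, F (z₀ + s • y) * avgKernel y)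
      (s * ∫ y : ℂ, (Δ F) (z₀ + s • y) * bump y) s := by
  have hb := isOpen_ball (x := z₀) (ε := r)
  have hF1 := fun v => hF.pd hb v
  set F' : ℝ → ℂ → ℝ := fun s y => fderiv ℝ F (z₀ + s • y) y * avgKernel y with hF'
  -- Since `avgKernel y • y` is minus the gradient of `bump`, the derivative in the radius is minus
  -- an inner product of gradients, and integration by parts produces the Laplacian of `F`.
  have eF' : ∀ s y, F' s y = -(pd 1 F (z₀ + s • y) * pd 1 bump y +
      pd Complex.I F (z₀ + s • y) * pd Complex.I bump y) := by
    intro s y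
    have : fderiv ℝ F (z₀ + s • y) y =
        y.re * pd 1 F (z₀ + s • y) + y.im * pd Complex.I F (z₀ + s • y) := by
      conv_lhs => rw [show y = y.re • (1 : ℂ) + y.im • Complex.I by
        apply Complex.ext <;> simp]
      rw [map_add, map_smul, map_smul]
      simp only [pd, smul_eq_mul]
      congr 4 <;> · apply Complex.ext <;> simp
    simp only [hF', this, pd_bump]
    simp [Complex.inner]
    ring
  have hi : ∀ v, Integrable fun y : ℂ => pd v F (z₀ + s • y) * pd v bump y := fun v =>
    integrable_comp_affine_mul (hF1 v).continuousOn hs (contDiff_bump.pd v).continuous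
      (fun _ hy => pd_bump_of_one_le v hy)
  have hint : ∫ y, F' s y = s * ∫ y : ℂ, (Δ F) (z₀ + s • y) * bump y := by
    have h1 : ∀ v, ∫ y : ℂ, pd v F (z₀ + s • y) * pd v bump y =
        -(s * ∫ y : ℂ, pd v (pd v F) (z₀ + s • y) * bump y) := by
      intro v
      rw [integral_mul_pd (isOpen_preimage_affine z₀ s r) (contDiffOn_comp_affine (hF1 v) s)
        contDiff_bump hasCompactSupport_bump
        (tsupport_subset_affine (fun _ => bump_of_one_le) hs), ← integral_const_mul]
      congr 1
      refine integral_congr_ae (Eventually.of_forall fun y => ?_)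
      rcases le_or_gt 1 ‖y‖ with hy | hy
      · simp [bump_of_one_le hy]
      · simp only
        rw [pd_comp_affine ((hF1 v).diffAt hb (affine_mem_ball hs hy.le))]
        ring
    have h2 : ∀ v, Integrable fun y : ℂ => pd v (pd v F) (z₀ + s • y) * bump y := fun v =>
      integrable_comp_affine_mul ((hF1 v).pd hb v).continuousOn hs contDiff_bump.continuous
        (fun _ => bump_of_one_le)
    simp_rw [eF']
    rw [integral_neg, integral_add (hi _) (hi _), h1, h1, ← neg_add, neg_neg, ← mul_add,
      ← integral_add (h2 _) (h2 _)]
    congr 1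
    refine integral_congr_ae (Eventually.of_forall fun y => ?_)
    rcases le_or_gt 1 ‖y‖ with hy | hy
    · simp [bump_of_one_le hy]
    · simp only
      rw [laplacian_eq_pd hF hb (affine_mem_ball hs hy.le)]
      ring
  rw [← hint]
  -- An intermediate radius: the gradient of `F` is bounded on the compact ball of radius `r'`,
  -- which dominates the integrands for all radii near `s`.
  set r' := (|s| + r) / 2 with hr'
  have hr1 : |s| < r' := by rw [hr']; linarith
  have hr2 : r' < r := by rw [hr']; linarith
  obtain ⟨B, hB⟩ := (isCompact_closedBall z₀ r').exists_bound_of_continuousOn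
    ((hF.fderiv_of_isOpen hb (m := ∞) (by simp)).continuousOn.mono (closedBall_subset_ball hr2))
  refine (hasDerivAt_integral_of_dominated_loc_of_deriv_le (s := ball 0 r')
    (bound := fun y => B * avgKernel y)
    (isOpen_ball.mem_nhds (by simpa using hr1)) ?_ ?_ ?_ ?_ ?_ ?_).2
  · filter_upwards [isOpen_ball.mem_nhds (show s ∈ ball (0 : ℝ) r' by simpa using hr1)] with t ht
    have ht' : |t| < r' := by simpa using ht
    exact (integrable_comp_affine_mul hF.continuousOn (ht'.trans hr2)
      contDiff_avgKernel.continuous (fun _ => avgKernel_of_one_le)).aestronglyMeasurable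
  · exact integrable_comp_affine_mul hF.continuousOn hs
      contDiff_avgKernel.continuous (fun _ => avgKernel_of_one_le)
  · simp_rw [funext (eF' s)]
    exact ((hi 1).add (hi Complex.I)).neg.aestronglyMeasurable
  · refine Eventually.of_forall fun y t ht => ?_
    have ht' : |t| < r' := by simpa using ht
    rcases le_or_gt 1 ‖y‖ with hy | hy
    · simp [hF', avgKernel_of_one_le hy]
    · have hm : z₀ + t • y ∈ closedBall z₀ r' := ball_subset_closedBall (affine_mem_ball ht' hy.le)
      rw [hF', norm_mul, Real.norm_of_nonneg (avgKernel_nonneg y)]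
      refine mul_le_mul_of_nonneg_right ?_ (avgKernel_nonneg y)
      refine (ContinuousLinearMap.le_opNorm _ _).trans ?_
      exact (mul_le_of_le_one_right (norm_nonneg _) hy.le).trans (hB _ hm)
  · exact integrable_avgKernel.const_mul B
  · refine Eventually.of_forall fun y t ht => ?_
    have ht' : |t| < r' := by simpa using ht
    rcases le_or_gt 1 ‖y‖ with hy | hy
    · simp only [hF', avgKernel_of_one_le hy, mul_zero]
      exact hasDerivAt_const _ _
    · exact (hasDerivAt_line hF hb z₀ y (affine_mem_ball (ht'.trans hr2) hy.le)).mul_const _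

/-- One-sided mean value inequality. -/
theorem mul_le_average_add (hF : ContDiffOn ℝ ∞ F (ball z₀ r)) (hs0 : 0 ≤ s) (hs : s < r) {K : ℝ}
    (hK0 : 0 ≤ K) (hK : ∀ z ∈ ball z₀ r, -K ≤ (Δ F) z) :
    (∫ y, avgKernel y) * F z₀ ≤
      (∫ y : ℂ, F (z₀ + s • y) * avgKernel y) + K * s ^ 2 * ∫ y, bump y := by
  have hb := isOpen_ball (x := z₀) (ε := r)
  have hD : ∀ t ∈ Icc 0 s, HasDerivAt (fun s : ℝ => ∫ y : ℂ, F (z₀ + s • y) * avgKernel y)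
      (t * ∫ y : ℂ, (Δ F) (z₀ + t • y) * bump y) t := fun t ht =>
    hasDerivAt_average hF (by rw [abs_of_nonneg ht.1]; exact ht.2.trans_lt hs)
  have hB : 0 ≤ ∫ y, bump y := integral_nonneg bump_nonneg
  -- At radius `t ≤ s` the average has derivative at least `-t K ∫ bump ≥ -s K ∫ bump`. Over `[0,
  -- s]` this loses `K s² ∫ bump`; the factor one half available by integrating `t` is given up.
  have := (convex_Icc 0 s).mul_sub_le_image_sub_of_le_deriv (C := -(s * (K * ∫ y, bump y)))
    (fun t ht => (hD t ht).continuousAt.continuousWithinAt)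
    (fun t ht => (hD t (interior_subset ht)).differentiableAt.differentiableWithinAt)
    (fun t ht => by
      have ht' := interior_subset ht
      have hts : |t| < r := by rw [abs_of_nonneg ht'.1]; exact ht'.2.trans_lt hs
      rw [(hD t ht').deriv]
      have h1 : -(K * ∫ y, bump y) ≤ ∫ y : ℂ, (Δ F) (z₀ + t • y) * bump y := by
        rw [← neg_mul, ← integral_const_mul]
        refine integral_mono (integrable_bump.const_mul _)
          (integrable_comp_affine_mul (continuousOn_laplacian hF hb) hts contDiff_bump.continuous
            (fun _ => bump_of_one_le)) fun y => ?_
        rcases le_or_gt 1 ‖y‖ with hy | hy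
        · simp [bump_of_one_le hy]
        · exact mul_le_mul_of_nonneg_right (hK _ (affine_mem_ball hts hy.le)) (bump_nonneg y)
      have h2 := mul_le_mul_of_nonneg_left h1 ht'.1
      have h3 := mul_le_mul_of_nonneg_right ht'.2 (mul_nonneg hK0 hB)
      linarith)
    0 ⟨le_rfl, hs0⟩ s ⟨hs0, le_rfl⟩ hs0
  simp only [zero_smul, add_zero, sub_zero] at this
  rw [integral_const_mul] at this
  nlinarith

theorem integral_average_eq (F : ℂ → ℝ) (z₀ : ℂ) (hs : 0 < s) :
    ∫ y : ℂ, F (z₀ + s • y) * avgKernel y =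
      ∫ x, F x * ((s ^ 2)⁻¹ * avgKernel (s⁻¹ • (x - z₀))) := by
  have h1 := Measure.integral_comp_smul (volume : Measure ℂ)
    (fun x => F (z₀ + x) * avgKernel (s⁻¹ • x)) s
  have h2 := integral_add_left_eq_self (μ := (volume : Measure ℂ))
    (fun x => F x * ((s ^ 2)⁻¹ * avgKernel (s⁻¹ • (x - z₀)))) z₀
  rw [← h2]
  simp only [Complex.finrank_real_complex, smul_eq_mul] at h1
  have h3 : ∀ y : ℂ, s⁻¹ • s • y = y := fun y => by rw [smul_smul, inv_mul_cancel₀ hs.ne', one_smul]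
  simp only [h3] at h1
  rw [h1, abs_of_pos (by positivity), ← integral_const_mul]
  refine integral_congr_ae (Eventually.of_forall fun y => ?_)
  simp only [add_sub_cancel_left]
  ring

theorem average_le {C : ℝ} (hC : ∀ y, avgKernel y ≤ C) (hs : 0 < s) {V : Set ℂ}
    (hV : ball z₀ s ⊆ V) (hVm : MeasurableSet V) (hF0 : ∀ x ∈ V, 0 ≤ F x)
    (hFi : IntegrableOn F V) :
    ∫ y : ℂ, F (z₀ + s • y) * avgKernel y ≤ (s ^ 2)⁻¹ * C * ∫ x in V, F x := by
  have hC0 : 0 ≤ C := (avgKernel_nonneg 0).trans (hC 0)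
  rw [integral_average_eq F z₀ hs, ← integral_const_mul, ← integral_indicator hVm]
  refine integral_mono_of_nonneg (Eventually.of_forall fun x => ?_)
    (IntegrableOn.integrable_indicator (hFi.const_mul _) hVm) (Eventually.of_forall fun x => ?_)
  all_goals
    simp only [Pi.zero_apply]
    by_cases hx : x ∈ V
    · have := hF0 x hx
      have := avgKernel_nonneg (s⁻¹ • (x - z₀))
      have := hC (s⁻¹ • (x - z₀))
      first
      | positivity
      | rw [indicator_of_mem hx, mul_comm (F x)]
        gcongr
    · have : avgKernel (s⁻¹ • (x - z₀)) = 0 := by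
        refine avgKernel_of_one_le ?_
        have : s ≤ ‖x - z₀‖ := by
          by_contra! h
          exact hx (hV (by rwa [mem_ball, dist_eq_norm]))
        rw [norm_smul, Real.norm_eq_abs, abs_of_pos (by positivity), inv_mul_eq_div]
        rwa [one_le_div hs]
      rw [this]; simp [hx]

end MeanValue

/-! ### ε-regularity by point picking. -/

section EpsilonRegularity

/-- A nonnegative `F` with `ΔF ≥ -8 F²` and small integral over a disc is bounded at the centre. -/
theorem exists_epsilon_regularity : ∃ ε C : ℝ, 0 < ε ∧ 0 < C ∧
    ∀ (F : ℂ → ℝ) (z₀ : ℂ) (s r : ℝ), 0 < s → s < r → ContDiffOn ℝ ∞ F (ball z₀ r) →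
      (∀ z ∈ ball z₀ r, 0 < F z) → (∀ z ∈ ball z₀ r, -(8 * F z ^ 2) ≤ (Δ F) z) →
      ∫ x in ball z₀ s, F x ≤ ε → F z₀ * s ^ 2 ≤ C := by
  obtain ⟨A, hA0, hA⟩ := exists_avgKernel_le
  set c := ∫ y, avgKernel y with hc
  have hc0 : 0 < c := integral_avgKernel_pos
  set b := ∫ y, bump y with hb
  have hb0 : 0 ≤ b := integral_nonneg bump_nonneg
  -- At radius `t` with `t² = κ / e` below, this `κ` makes the Laplacian error `128 e² t² b` at most
  -- `c e / 4`, and `ε = c κ / (4 A)` makes the average at most `c e / 4`.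
  set κ := c / (512 * (b + 1)) with hκ
  have hκ0 : 0 < κ := by positivity
  refine ⟨c * κ / (4 * A), 4 * κ, by positivity, by positivity, ?_⟩
  intro F z₀ s r hs hsr hF hpos hΔ hint
  have hsub : closedBall z₀ s ⊆ ball z₀ r := closedBall_subset_ball hsr
  -- Point picking: maximise `F` times the squared distance to the boundary. Around the maximiser,
  -- within half its boundary distance `d`, `F` is at most four times its value there, which makes
  -- `ΔF ≥ -8F²` a bound by a constant.
  obtain ⟨z₁, hz₁, hmax⟩ := (isCompact_closedBall z₀ s).exists_isMaxOn
    ⟨z₀, mem_closedBall_self hs.le⟩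
    (f := fun z => (s - dist z z₀) ^ 2 * F z)
    (((continuous_const.sub (continuous_id.dist continuous_const)).pow 2).continuousOn.mul
      (hF.continuousOn.mono hsub))
  have h0 := hmax (mem_closedBall_self hs.le)
  simp only [mem_ofPred_eq, dist_self, sub_zero] at h0
  set d := s - dist z₁ z₀ with hd
  have he0 : 0 < F z₁ := hpos z₁ (hsub hz₁)
  have hd0 : 0 < d := by
    have h1 : 0 ≤ d := by rw [hd]; linarith [mem_closedBall.1 hz₁]
    rcases h1.eq_or_lt with h | h
    · rw [← h] at h0
      have := hpos z₀ (hsub (mem_closedBall_self hs.le))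
      have : 0 < s ^ 2 * F z₀ := by positivity
      simp at h0
      linarith
    · exact h
  -- Otherwise the radius `t` fits inside `d / 2`, and the mean value inequality gives `c e ≤ c e /
  -- 4 + c e / 4`. Maximality then transfers the bound from `z₁` to `z₀`.
  have hkey : F z₁ * (d / 2) ^ 2 ≤ κ := by
    by_contra! hcon
    set e := F z₁ with he
    have ht2 : κ / e < (d / 2) ^ 2 := by rw [div_lt_iff₀ he0]; linarith
    set t := Real.sqrt (κ / e) with ht
    have htsq : t ^ 2 = κ / e := Real.sq_sqrt (by positivity)
    have ht0 : 0 < t := Real.sqrt_pos.2 (by positivity)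
    have htd : t < d / 2 := lt_of_pow_lt_pow_left₀ 2 (by positivity) (by rw [htsq]; exact ht2)
    have hsub1 : ball z₁ (d / 2) ⊆ ball z₀ s := by
      intro z hz
      rw [mem_ball] at hz ⊢
      have := dist_triangle z z₁ z₀
      rw [hd] at hz hd0
      linarith
    have hsub2 := hsub1.trans (ball_subset_closedBall.trans hsub)
    have hF4 : ∀ z ∈ ball z₁ (d / 2), F z ≤ 4 * e := by
      intro z hz
      have h1 := hmax (ball_subset_closedBall (hsub1 hz))
      simp only [mem_ofPred_eq] at h1
      have h2 : d / 2 ≤ s - dist z z₀ := by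
        rw [mem_ball] at hz
        have := dist_triangle z z₁ z₀
        linarith
      have h3 : (d / 2) ^ 2 ≤ (s - dist z z₀) ^ 2 := by
        apply pow_le_pow_left₀ (by positivity) h2
      have h4 := mul_le_mul_of_nonneg_right h3 (hpos z (hsub2 hz)).le
      have h5 : d ^ 2 * F z ≤ d ^ 2 * (4 * e) := by nlinarith
      exact le_of_mul_le_mul_left h5 (by positivity)
    have hmv := mul_le_average_add (hF.mono hsub2) ht0.le htd (K := 128 * e ^ 2) (by positivity)
      (fun z hz => by
        have h1 := hΔ z (hsub2 hz)
        have h2 := hF4 z hz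
        have h3 := (hpos z (hsub2 hz)).le
        nlinarith)
    have hav := average_le hA ht0 (F := F) ((ball_subset_ball htd.le).trans hsub1) measurableSet_ball
      (fun x hx => (hpos x (hsub (ball_subset_closedBall hx))).le)
      (((hF.continuousOn.mono hsub).integrableOn_compact (isCompact_closedBall z₀ s)).mono_set
        ball_subset_closedBall)
    rw [← hc, ← hb] at hmv
    have h6 : (t ^ 2)⁻¹ * A * ∫ x in ball z₀ s, F x ≤ c * e / 4 := by
      calc (t ^ 2)⁻¹ * A * ∫ x in ball z₀ s, F x ≤ (t ^ 2)⁻¹ * A * (c * κ / (4 * A)) := by gcongr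
        _ = c * e / 4 := by rw [htsq]; field_simp
    have h7 : 128 * e ^ 2 * t ^ 2 * b ≤ c * e / 4 := by
      have h8 : κ * b ≤ c / 512 := by
        rw [hκ, div_mul_eq_mul_div, div_le_div_iff₀ (by positivity) (by positivity)]
        nlinarith
      calc 128 * e ^ 2 * t ^ 2 * b = 128 * e * (κ * b) := by rw [htsq]; field_simp
        _ ≤ 128 * e * (c / 512) := by gcongr
        _ = c * e / 4 := by ring
    have : 0 < c * e := by positivity
    linarith
  nlinarith

end EpsilonRegularity

/-! ### From the weak equation to the classical one. -/

section WeakEquation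

variable {u h : ℂ → ℝ} {U : Set ℂ}

/-- A weak solution which is smooth on an open set is a classical solution there. -/
theorem laplacian_eq_of_weak (hU : IsOpen U) (hu : ContDiffOn ℝ ∞ u U) (hh : ContDiffOn ℝ ∞ h U)
    (hw : ∀ φ : ℂ → ℝ, ContDiff ℝ ∞ φ → HasCompactSupport φ → tsupport φ ⊆ U →
      (∫ z, u z * (Δ φ) z) + (∫ z, 4 * Real.exp (h z) * φ z) = 0) {z : ℂ} (hz : z ∈ U) :
    (Δ u) z = -(4 * Real.exp (h z)) := by
  have hc : ContinuousOn (fun z => (Δ u) z + 4 * Real.exp (h z)) U :=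
    (continuousOn_laplacian hu hU).add (hh.continuousOn.rexp.const_mul 4)
  have hc2 : ContinuousOn (fun z => 4 * Real.exp (h z)) U := hh.continuousOn.rexp.const_mul 4
  have h1 := hU.ae_eq_zero_of_integral_contDiff_smul_eq_zero (μ := volume)
    (hc.locallyIntegrableOn hU.measurableSet) (fun φ hφ hφc hφU => by
      have e := hw φ hφ hφc hφU
      rw [integral_mul_laplacian hU hu hφ hφc hφU, ← integral_add
        (integrable_mul_of_tsupport_subset hU (continuousOn_laplacian hu hU) hφ.continuous hφc hφU)
        (integrable_mul_of_tsupport_subset hU hc2 hφ.continuous hφc hφU)] at e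
      rw [← e]
      refine integral_congr_ae (Eventually.of_forall fun x => ?_)
      simp only [smul_eq_mul]
      ring)
  have h2 := Measure.eqOn_open_of_ae_eq (μ := volume) (g := fun _ => (0 : ℝ))
    ((ae_restrict_iff' hU.measurableSet).2 h1) hU hc continuousOn_const hz
  simp only at h2
  linarith

end WeakEquation

/-! ### Truncated logarithms as test functions. -/

section TestFunction

theorem laplacian_logPotential_comp (z₀ : ℂ) (s : ℝ) (x : ℂ) :
    (Δ fun x : ℂ => logPotential (s⁻¹ • (x - z₀))) x =
      (s ^ 2)⁻¹ * avgKernel (s⁻¹ • (x - z₀)) := by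
  have e : ∀ x : ℂ, s⁻¹ • (x - z₀) = -(s⁻¹ • z₀) + s⁻¹ • x := fun x => by
    rw [smul_sub]; abel
  simp_rw [e]
  have hs : ContDiff ℝ ∞ fun x : ℂ => logPotential (-(s⁻¹ • z₀) + s⁻¹ • x) :=
    contDiff_logPotential.comp (by fun_prop)
  have h1 : ∀ v, pd v (fun x : ℂ => logPotential (-(s⁻¹ • z₀) + s⁻¹ • x)) =
      s⁻¹ • fun x => pd v logPotential (-(s⁻¹ • z₀) + s⁻¹ • x) := fun v => by
    ext y
    exact pd_comp_affine (contDiff_logPotential.contDiffAt.differentiableAt (by simp)) v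
  have h2 : ∀ v, pd v (pd v fun x : ℂ => logPotential (-(s⁻¹ • z₀) + s⁻¹ • x)) x =
      (s ^ 2)⁻¹ * pd v (pd v logPotential) (-(s⁻¹ • z₀) + s⁻¹ • x) := fun v => by
    have hd : DifferentiableAt ℝ (pd v logPotential) (-(s⁻¹ • z₀) + s⁻¹ • x) :=
      (contDiff_logPotential.pd v).contDiffAt.differentiableAt (by simp)
    have hd' : DifferentiableAt ℝ (fun x : ℂ => pd v logPotential (-(s⁻¹ • z₀) + s⁻¹ • x)) x :=
      hd.comp (f := fun x : ℂ => -(s⁻¹ • z₀) + s⁻¹ • x) x (by fun_prop)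
    rw [h1, pd, fderiv_const_smul hd']
    have := pd_comp_affine hd v
    rw [pd] at this
    rw [smul_apply, smul_eq_mul, this]
    ring
  rw [laplacian_eq_pd hs.contDiffOn isOpen_univ (mem_univ x), h2, h2, ← mul_add,
    ← laplacian_eq_pd contDiff_logPotential.contDiffOn isOpen_univ (mem_univ _),
    laplacian_logPotential]

/-- A compactly supported function whose Laplacian is the difference of the averaging kernels of
radii `s` and `S` about `z₀`. -/
noncomputable def annularTest (z₀ : ℂ) (s S : ℝ) (x : ℂ) : ℝ :=
  logPotential (s⁻¹ • (x - z₀)) - logPotential (S⁻¹ • (x - z₀)) - Real.log (S / s)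

variable {z₀ : ℂ} {s S : ℝ}

theorem contDiff_logPotential_comp (z₀ : ℂ) (s : ℝ) :
    ContDiff ℝ ∞ fun x : ℂ => logPotential (s⁻¹ • (x - z₀)) :=
  contDiff_logPotential.comp (by fun_prop)

theorem contDiff_annularTest : ContDiff ℝ ∞ (annularTest z₀ s S) :=
  ((contDiff_logPotential_comp z₀ s).sub (contDiff_logPotential_comp z₀ S)).sub contDiff_const

theorem laplacian_annularTest (x : ℂ) : (Δ (annularTest z₀ s S)) x =
    (s ^ 2)⁻¹ * avgKernel (s⁻¹ • (x - z₀)) - (S ^ 2)⁻¹ * avgKernel (S⁻¹ • (x - z₀)) := by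
  have h1 : ∀ s, ContDiffAt ℝ 2 (fun x : ℂ => logPotential (s⁻¹ • (x - z₀))) x := fun s =>
    (contDiff_logPotential_comp z₀ s).contDiffAt.of_le (by simpa using ENat.LEInfty.out)
  have h2 : annularTest z₀ s S = ((fun x : ℂ => logPotential (s⁻¹ • (x - z₀))) -
    fun x : ℂ => logPotential (S⁻¹ • (x - z₀))) - fun _ => Real.log (S / s) := rfl
  have h3 : ContDiffAt ℝ 2 ((fun x : ℂ => logPotential (s⁻¹ • (x - z₀))) -
    fun x : ℂ => logPotential (S⁻¹ • (x - z₀))) x := (h1 s).sub (h1 S)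
  rw [h2, h3.laplacian_sub contDiffAt_const, (h1 s).laplacian_sub (h1 S)]
  simp only [laplacian_logPotential_comp, InnerProductSpace.laplacian_const]
  simp

theorem norm_inv_smul (hs : 0 < s) (y : ℂ) : ‖s⁻¹ • y‖ = ‖y‖ / s := by
  rw [norm_smul, Real.norm_eq_abs, abs_of_pos (by positivity), inv_mul_eq_div]

theorem logPotential_of_one_le {y : ℂ} (h : 1 ≤ ‖y‖) : logPotential y = lam 1 + Real.log ‖y‖ := by
  rw [logPotential, lam_of_one_le (by nlinarith), Real.log_pow]
  simp

theorem logPotential_mem {y : ℂ} (h : ‖y‖ ≤ 1) : logPotential y ∈ Icc 0 (lam 1) := by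
  constructor
  · rw [← lam_zero]; exact monotone_lam (by positivity)
  · exact monotone_lam (by nlinarith [norm_nonneg y])

/-- Beyond radius `S` both potentials are exact logarithms up to the same constant `lam 1`, so their
difference is the subtracted constant `log (S / s)`. -/
theorem annularTest_eq_zero (hs : 0 < s) (hsS : s ≤ S) {x : ℂ} (hx : S ≤ ‖x - z₀‖) :
    annularTest z₀ s S x = 0 := by
  have hS : 0 < S := hs.trans_le hsS
  have hx0 : 0 < ‖x - z₀‖ := hS.trans_le hx
  have h1 : 1 ≤ ‖s⁻¹ • (x - z₀)‖ := by
    rw [norm_inv_smul hs, one_le_div hs]; linarith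
  have h2 : 1 ≤ ‖S⁻¹ • (x - z₀)‖ := by
    rw [norm_inv_smul hS, one_le_div hS]; linarith
  rw [annularTest, logPotential_of_one_le h1, logPotential_of_one_le h2, norm_inv_smul hs,
    norm_inv_smul hS, Real.log_div hx0.ne' hs.ne', Real.log_div hx0.ne' hS.ne',
    Real.log_div hS.ne' hs.ne']
  ring

/-- The term `log (S / s)` is the source of the logarithmic growth rate of solutions at a point
source. -/
theorem abs_annularTest_le (hs : 0 < s) (hsS : s ≤ S) (x : ℂ) :
    |annularTest z₀ s S x| ≤ lam 1 + Real.log (S / s) := by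
  have hS : 0 < S := hs.trans_le hsS
  have hl : 0 ≤ Real.log (S / s) := Real.log_nonneg (by rwa [one_le_div hs])
  have hl1 : 0 ≤ lam 1 := by rw [← lam_zero]; exact monotone_lam zero_le_one
  rcases le_or_gt S ‖x - z₀‖ with hx | hx
  · rw [annularTest_eq_zero hs hsS hx, abs_zero]; positivity
  · have h2 := logPotential_mem (y := S⁻¹ • (x - z₀)) (by
      rw [norm_inv_smul hS, div_le_one hS]; exact hx.le)
    have h3 : 0 ≤ logPotential (s⁻¹ • (x - z₀)) ∧
        logPotential (s⁻¹ • (x - z₀)) ≤ lam 1 + Real.log (S / s) := by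
      rcases le_total ‖s⁻¹ • (x - z₀)‖ 1 with h | h
      · have := logPotential_mem h
        exact ⟨this.1, by linarith [this.2]⟩
      · rw [logPotential_of_one_le h]
        refine ⟨by have := Real.log_nonneg h; positivity, ?_⟩
        gcongr
        rw [norm_inv_smul hs]
        gcongr
    rw [annularTest, abs_le]
    constructor <;> linarith [h2.1, h2.2, h3.1, h3.2]

theorem tsupport_annularTest (hs : 0 < s) (hsS : s ≤ S) :
    tsupport (annularTest z₀ s S) ⊆ closedBall z₀ S := by
  refine closure_minimal (fun x hx => ?_) isClosed_closedBall
  rw [mem_closedBall, dist_eq_norm]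
  by_contra! hcon
  exact hx (annularTest_eq_zero hs hsS hcon.le)

theorem hasCompactSupport_annularTest (hs : 0 < s) (hsS : s ≤ S) :
    HasCompactSupport (annularTest z₀ s S) :=
  (isCompact_closedBall z₀ S).of_isClosed_subset (isClosed_tsupport _) (tsupport_annularTest hs hsS)

end TestFunction

/-! ### Logarithmic growth at a point source. -/

section LogBound

variable {u h : ℂ → ℝ} {p z₀ : ℂ} {s S : ℝ}

theorem abs_integral_mul_le {f φ : ℂ → ℝ} (hf : LocallyIntegrable f) {M : ℝ}
    (hφ : ∀ x, |φ x| ≤ M) (hsupp : ∀ x, x ∉ closedBall p 1 → φ x = 0) :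
    |∫ x, f x * φ x| ≤ M * ∫ x in closedBall p 1, |f x| := by
  have hi : IntegrableOn (fun x => |f x|) (closedBall p 1) :=
    (hf.integrableOn_isCompact (isCompact_closedBall p 1)).abs
  rw [← Real.norm_eq_abs, ← integral_const_mul, ← integral_indicator measurableSet_closedBall]
  refine norm_integral_le_of_norm_le
    (IntegrableOn.integrable_indicator (hi.const_mul M) measurableSet_closedBall)
    (Eventually.of_forall fun x => ?_)
  by_cases hx : x ∈ closedBall p 1
  · rw [indicator_of_mem hx, Real.norm_eq_abs, abs_mul, mul_comm]
    exact mul_le_mul_of_nonneg_right (hφ x) (abs_nonneg _)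
  · rw [hsupp x hx]; simp [hx]

/-- In the application `x = u z₀`, `J₁` and `J₂` are the averages of `u` at the small and the large
radius, `k` is the mean value error, `E` the integral of the exponential term and `T` the
contribution of the source. -/
theorem abs_le_of_average_identity {c x J₁ J₂ E T k P Q R : ℝ} (h1 : c * x ≤ J₁ + k)
    (h2 : c * -x ≤ -J₁ + k) (h3 : J₁ - J₂ + E = T) (hP : |J₂| ≤ P) (hQ : |E| ≤ Q) (hR : |T| ≤ R) :
    |c * x| ≤ k + P + Q + R := by
  rw [abs_le] at *
  constructor <;> linarith [hP.1, hP.2, hQ.1, hQ.2, hR.1, hR.2]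

set_option maxHeartbeats 1000000 in
/-- A solution with a point source at `p` grows at most logarithmically at `p`. -/
theorem exists_abs_le_log {γ C ρ₀ : ℝ} (hsm : ContDiffOn ℝ ∞ u (ball p 1 \ {p}))
    (hu : LocallyIntegrable u) (he : LocallyIntegrable fun z => Real.exp (h z))
    (hw : ∀ φ : ℂ → ℝ, ContDiff ℝ ∞ φ → HasCompactSupport φ → tsupport φ ⊆ ball p 1 →
      (∫ z, u z * (Δ φ) z) + (∫ z, 4 * Real.exp (h z) * φ z) = 4 * Real.pi * (γ * φ p))
    (hρ₀ : 0 < ρ₀) (hC : 0 ≤ C)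
    (hΔ : ∀ z, z ≠ p → ‖z - p‖ < ρ₀ → |(Δ u) z| ≤ C / ‖z - p‖ ^ 2) :
    ∃ C' ρ : ℝ, 0 < C' ∧ 0 < ρ ∧ ρ < 1 ∧
      ∀ z, z ≠ p → ‖z - p‖ < ρ → |u z| ≤ C' * (1 - Real.log ‖z - p‖) := by
  obtain ⟨A, hA0, hA⟩ := exists_avgKernel_le
  set c := ∫ y, avgKernel y with hc
  have hc0 : 0 < c := integral_avgKernel_pos
  set b := ∫ y, bump y with hb
  have hb0 : 0 ≤ b := integral_nonneg bump_nonneg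
  set I₁ := ∫ x in closedBall p 1, |u x| with hI₁
  have hI₁0 : 0 ≤ I₁ := integral_nonneg fun _ => abs_nonneg _
  have he4 : LocallyIntegrable fun z => 4 * Real.exp (h z) := he.smul (4 : ℝ)
  set I₂ := ∫ x in closedBall p 1, |4 * Real.exp (h x)| with hI₂
  have hI₂0 : 0 ≤ I₂ := integral_nonneg fun _ => abs_nonneg _
  have hl1 : 0 ≤ lam 1 := by rw [← lam_zero]; exact monotone_lam zero_le_one
  set G := I₂ + 4 * Real.pi * |γ| with hG
  have hG0 : 0 ≤ G := by positivity
  set C' := (4 * C * b + 4 * A * I₁ + (lam 1 + 1) * G) / c + 1 with hC'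
  refine ⟨C', min (1 / 8) (ρ₀ / 2), by positivity, by positivity,
    (min_le_left _ _).trans_lt (by norm_num), ?_⟩
  intro z₀ hz₀ hlt
  set ρ := ‖z₀ - p‖ with hρ
  have hρ0 : 0 < ρ := norm_pos_iff.2 (sub_ne_zero.2 hz₀)
  have hρ8 : ρ < 1 / 8 := hlt.trans_le (min_le_left _ _)
  have hρρ : ρ < ρ₀ / 2 := hlt.trans_le (min_le_right _ _)
  have hlog : Real.log ρ < 0 := Real.log_neg hρ0 (by linarith)
  have hs : 0 < ρ / 4 := by positivity
  have hsS : ρ / 4 ≤ 1 / 2 := by linarith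
  have hball : ∀ z ∈ ball z₀ (ρ / 2), ρ / 2 < ‖z - p‖ ∧ ‖z - p‖ < 2 * ρ := by
    intro z hz
    rw [mem_ball, dist_eq_norm] at hz
    have h1 : ‖z₀ - p‖ ≤ ‖z - z₀‖ + ‖z - p‖ := by
      have := norm_sub_le (z - p) (z - z₀)
      rw [show z - p - (z - z₀) = z₀ - p by ring] at this
      linarith
    have h2 : ‖z - p‖ ≤ ‖z - z₀‖ + ‖z₀ - p‖ := by
      have := norm_add_le (z - z₀) (z₀ - p)
      rwa [show z - z₀ + (z₀ - p) = z - p by ring] at this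
    constructor <;> linarith
  have husm : ContDiffOn ℝ ∞ u (ball z₀ (ρ / 2)) := hsm.mono fun z hz => by
    have := hball z hz
    refine ⟨by rw [mem_ball, dist_eq_norm]; linarith, ?_⟩
    rintro rfl
    rw [sub_self, norm_zero] at this
    linarith
  have hΔ' : ∀ z ∈ ball z₀ (ρ / 2), |(Δ u) z| ≤ 4 * C / ρ ^ 2 := by
    intro z hz
    have h1 := hball z hz
    refine (hΔ z (by rintro rfl; rw [sub_self, norm_zero] at h1; linarith) (by linarith)).trans ?_
    have : (ρ / 2) ^ 2 ≤ ‖z - p‖ ^ 2 := by gcongr; exact h1.1.le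
    rw [div_le_div_iff₀ (by linarith [show 0 < (ρ / 2) ^ 2 by positivity]) (by positivity)]
    nlinarith
  -- Applied to `u` and to `-u`, the inequality compares `u z₀` with its average at radius `ρ / 4`
  -- up to a scale-invariant error.
  have hm1 := mul_le_average_add husm hs.le (by linarith) (K := 4 * C / ρ ^ 2) (by positivity)
    (fun z hz => (abs_le.1 (hΔ' z hz)).1)
  have hm2 := mul_le_average_add (F := -u) husm.neg hs.le (by linarith) (K := 4 * C / ρ ^ 2)
    (by positivity) (fun z hz => by
      rw [InnerProductSpace.laplacian_neg, Pi.neg_apply]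
      linarith [(abs_le.1 (hΔ' z hz)).2])
  simp only [Pi.neg_apply, neg_mul, integral_neg] at hm2
  rw [integral_average_eq u z₀ hs, ← hc, ← hb] at hm1
  rw [integral_average_eq u z₀ hs, ← hc, ← hb] at hm2
  have hKs : 4 * C / ρ ^ 2 * (ρ / 4) ^ 2 * b ≤ 4 * C * b := by
    have : 4 * C / ρ ^ 2 * (ρ / 4) ^ 2 * b = 4 * C * b / 16 := by field_simp; ring
    rw [this]; linarith [show 0 ≤ 4 * C * b by positivity]
  -- Testing the equation with this function replaces the average at radius `ρ / 4` by that at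
  -- radius `1 / 2`, which the `L¹` norm of `u` bounds uniformly in `z₀`. The price is the size of
  -- `φ` times the mass of the exponential term and of the source. The support lies in the unit disc
  -- about `p` because `ρ < 1 / 8`.
  set φ := annularTest z₀ (ρ / 4) (1 / 2) with hφ
  have hsupp : tsupport φ ⊆ ball p 1 := (tsupport_annularTest hs hsS).trans fun z hz => by
    rw [mem_closedBall, dist_eq_norm] at hz
    rw [mem_ball, dist_eq_norm]
    have := norm_add_le (z - z₀) (z₀ - p)
    rw [show z - z₀ + (z₀ - p) = z - p by ring] at this
    linarith
  have hweak := hw φ contDiff_annularTest (hasCompactSupport_annularTest hs hsS) hsupp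
  have hint : ∀ s : ℝ, 0 < s →
      Integrable fun x => u x * ((s ^ 2)⁻¹ * avgKernel (s⁻¹ • (x - z₀))) := by
    intro s hs
    have hcs : HasCompactSupport fun x => (s ^ 2)⁻¹ * avgKernel (s⁻¹ • (x - z₀)) := by
      refine HasCompactSupport.intro (isCompact_closedBall z₀ s) fun x hx => ?_
      rw [mem_closedBall, dist_eq_norm, not_le] at hx
      rw [avgKernel_of_one_le, mul_zero]
      rw [norm_inv_smul hs, one_le_div hs]; exact hx.le
    have hcc : Continuous fun x : ℂ => (s ^ 2)⁻¹ * avgKernel (s⁻¹ • (x - z₀)) :=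
      continuous_const.mul (contDiff_avgKernel.continuous.comp (by fun_prop))
    have := hu.integrable_smul_right_of_hasCompactSupport hcc hcs
    simpa only [smul_eq_mul] using this
  have hsplit : ∫ z, u z * (Δ φ) z =
      (∫ x, u x * (((ρ / 4) ^ 2)⁻¹ * avgKernel ((ρ / 4)⁻¹ • (x - z₀)))) -
        ∫ x, u x * (((1 / 2 : ℝ) ^ 2)⁻¹ * avgKernel ((1 / 2 : ℝ)⁻¹ • (x - z₀))) := by
    rw [← integral_sub (hint _ hs) (hint _ (by norm_num))]
    refine integral_congr_ae (Eventually.of_forall fun x => ?_)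
    simp only [hφ]
    rw [laplacian_annularTest]
    ring
  have hfar : |∫ x, u x * (((1 / 2 : ℝ) ^ 2)⁻¹ * avgKernel ((1 / 2 : ℝ)⁻¹ • (x - z₀)))| ≤
      4 * A * I₁ := by
    refine abs_integral_mul_le hu (fun x => ?_) fun x hx => ?_
    · rw [abs_of_nonneg (mul_nonneg (by positivity) (avgKernel_nonneg _))]
      have := hA ((1 / 2 : ℝ)⁻¹ • (x - z₀))
      norm_num at this ⊢
      linarith
    · rw [avgKernel_of_one_le, mul_zero]
      rw [norm_inv_smul (by norm_num), one_le_div (by norm_num)]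
      rw [mem_closedBall, dist_eq_norm, not_le] at hx
      have := norm_add_le (x - z₀) (z₀ - p)
      rw [show x - z₀ + (z₀ - p) = x - p by ring] at this
      linarith
  set Λ := lam 1 + Real.log (1 / 2 / (ρ / 4)) with hΛ
  have hφb : ∀ x, |φ x| ≤ Λ := fun x => abs_annularTest_le hs hsS x
  have hexp : |∫ z, 4 * Real.exp (h z) * φ z| ≤ Λ * I₂ := by
    refine abs_integral_mul_le he4 hφb fun x hx => ?_
    refine image_eq_zero_of_notMem_tsupport fun hx' => hx (ball_subset_closedBall (hsupp hx'))
  have hsrc : |4 * Real.pi * (γ * φ p)| ≤ Λ * (4 * Real.pi * |γ|) := by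
    rw [abs_mul, abs_mul γ, abs_of_pos (show 0 < 4 * Real.pi by positivity)]
    have := mul_le_mul_of_nonneg_left (hφb p) (show 0 ≤ 4 * Real.pi * |γ| by positivity)
    linarith
  have hΛ2 : Λ ≤ (lam 1 + 1) * (1 - Real.log ρ) := by
    have : Real.log (1 / 2 / (ρ / 4)) = Real.log 2 - Real.log ρ := by
      rw [← Real.log_div (by norm_num) hρ0.ne']; congr 1; field_simp; norm_num
    rw [hΛ, this]
    have := Real.log_two_lt_d9
    nlinarith
  have hX : c * |u z₀| ≤ 4 * C * b + 4 * A * I₁ + Λ * G := by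
    rw [hsplit] at hweak
    have := abs_le_of_average_identity (hm1.trans (by gcongr)) (hm2.trans (by gcongr)) hweak
      hfar hexp hsrc
    rw [abs_mul, abs_of_pos hc0] at this
    rw [hG]
    linarith
  have hY : c * |u z₀| ≤ (4 * C * b + 4 * A * I₁ + (lam 1 + 1) * G) * (1 - Real.log ρ) := by
    have h1 := mul_le_mul_of_nonneg_right hΛ2 hG0
    have h2 : 0 ≤ 4 * C * b + 4 * A * I₁ := by positivity
    have h3 := mul_nonneg h2 (neg_nonneg.2 hlog.le)
    linarith
  have : |u z₀| ≤ (4 * C * b + 4 * A * I₁ + (lam 1 + 1) * G) / c * (1 - Real.log ρ) := by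
    rw [div_mul_eq_mul_div, le_div_iff₀ hc0]; linarith
  rw [hC']
  linarith

end LogBound

/-! ### Wirtinger calculus. -/

section Wirtinger

/-- The complex vector field `α ∂_{x₁} + β ∂_{x₂}` applied to `f`. -/
noncomputable def wirt (α β : ℂ) (f : ℂ → ℂ) (z : ℂ) : ℂ := α * pd 1 f z + β * pd Complex.I f z

/-- The derivative `∂_{z̄}`. -/
noncomputable def dzbar : (ℂ → ℂ) → ℂ → ℂ := wirt (1 / 2) (Complex.I / 2)

theorem dz_eq_wirt : dz = wirt (1 / 2) (-Complex.I / 2) := by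
  ext f z
  simp only [dz, wirt, pd]
  ring

/-- `f` is differentiable at `z` with derivative `f'` along `α ∂_{x₁} + β ∂_{x₂}`. -/
def HasWirt (α β : ℂ) (f : ℂ → ℂ) (f' z : ℂ) : Prop := DifferentiableAt ℝ f z ∧ wirt α β f z = f'

variable {α β z f' g' : ℂ} {f g : ℂ → ℂ} {U : Set ℂ}

theorem HasWirt.add (hf : HasWirt α β f f' z) (hg : HasWirt α β g g' z) :
    HasWirt α β (fun z => f z + g z) (f' + g') z := by
  refine ⟨hf.1.add hg.1, ?_⟩
  rw [← hf.2, ← hg.2]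
  simp only [wirt, pd, fderiv_fun_add hf.1 hg.1, add_apply]
  ring

theorem HasWirt.sub (hf : HasWirt α β f f' z) (hg : HasWirt α β g g' z) :
    HasWirt α β (fun z => f z - g z) (f' - g') z := by
  refine ⟨hf.1.sub hg.1, ?_⟩
  rw [← hf.2, ← hg.2]
  simp only [wirt, pd, fderiv_fun_sub hf.1 hg.1, sub_apply]
  ring

theorem HasWirt.mul (hf : HasWirt α β f f' z) (hg : HasWirt α β g g' z) :
    HasWirt α β (fun z => f z * g z) (f' * g z + f z * g') z := by
  refine ⟨hf.1.mul hg.1, ?_⟩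
  rw [← hf.2, ← hg.2]
  simp only [wirt, pd, fderiv_fun_mul hf.1 hg.1, add_apply, smul_apply, smul_eq_mul]
  ring

theorem HasWirt.const_mul (hf : HasWirt α β f f' z) (c : ℂ) :
    HasWirt α β (fun z => c * f z) (c * f') z := by
  refine ⟨hf.1.const_mul c, ?_⟩
  rw [← hf.2]
  simp only [wirt, pd, fderiv_const_mul hf.1, smul_apply, smul_eq_mul]
  ring

theorem HasWirt.congr (hf : HasWirt α β f f' z) (hU : IsOpen U) (hz : z ∈ U) (h : EqOn g f U) :
    HasWirt α β g f' z := by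
  have e := h.eventuallyEq_of_mem (hU.mem_nhds hz)
  refine ⟨hf.1.congr_of_eventuallyEq e, ?_⟩
  rw [← hf.2]
  simp only [wirt, pd, e.fderiv_eq]

theorem HasWirt.dz_eq (hf : HasWirt (1 / 2) (-Complex.I / 2) f f' z) : dz f z = f' := by
  rw [dz_eq_wirt]; exact hf.2

theorem hasWirt (hf : ContDiffOn ℝ ∞ f U) (hU : IsOpen U) (hz : z ∈ U) (α β : ℂ) :
    HasWirt α β f (wirt α β f z) z := ⟨hf.diffAt hU hz, rfl⟩

theorem _root_.ContDiffOn.wirt (hf : ContDiffOn ℝ ∞ f U) (hU : IsOpen U) (α β : ℂ) :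
    ContDiffOn ℝ ∞ (SU3Toda.wirt α β f) U :=
  (contDiffOn_const.mul (hf.pd hU 1)).add (contDiffOn_const.mul (hf.pd hU Complex.I))

theorem pd_wirt (hf : ContDiffOn ℝ ∞ f U) (hU : IsOpen U) (hz : z ∈ U) (α β v : ℂ) :
    pd v (wirt α β f) z = wirt α β (pd v f) z := by
  have h1 := (hf.pd hU 1).diffAt hU hz
  have h2 := (hf.pd hU Complex.I).diffAt hU hz
  have : wirt α β f = fun z => α * pd 1 f z + β * pd Complex.I f z := rfl
  rw [pd, this, fderiv_fun_add (h1.const_mul α) (h2.const_mul β), fderiv_const_mul h1,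
    fderiv_const_mul h2]
  simp only [add_apply, smul_apply, smul_eq_mul, wirt]
  rw [pd_comm hf hU hz 1 v, pd_comm hf hU hz Complex.I v]
  rfl

theorem wirt_comm (hf : ContDiffOn ℝ ∞ f U) (hU : IsOpen U) (hz : z ∈ U) (α β γ δ : ℂ) :
    wirt α β (wirt γ δ f) z = wirt γ δ (wirt α β f) z := by
  rw [wirt, pd_wirt hf hU hz, pd_wirt hf hU hz]
  conv_rhs => rw [wirt, pd_wirt hf hU hz, pd_wirt hf hU hz]
  simp only [wirt]
  rw [pd_comm hf hU hz 1 Complex.I]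
  ring

theorem laplacian_eq_dz_dzbar (hf : ContDiffOn ℝ ∞ f U) (hU : IsOpen U) (hz : z ∈ U) :
    (Δ f) z = 4 * dz (dzbar f) z := by
  rw [laplacian_eq_pd hf hU hz, dz_eq_wirt, dzbar]
  conv_rhs => rw [wirt, pd_wirt hf hU hz, pd_wirt hf hU hz]
  simp only [wirt]
  rw [pd_comm hf hU hz 1 Complex.I]
  linear_combination pd Complex.I (pd Complex.I f) z * Complex.I_sq

/-- These are the Cauchy–Riemann equations. -/
theorem differentiableAt_of_dzbar_eq_zero (h : HasWirt (1 / 2) (Complex.I / 2) f 0 z) :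
    DifferentiableAt ℂ f z := by
  rw [differentiableAt_complex_iff_differentiableAt_real]
  refine ⟨h.1, ?_⟩
  have := h.2
  simp only [wirt, pd] at this
  rw [smul_eq_mul]
  linear_combination (-2 * Complex.I) * this + fderiv ℝ f z Complex.I * Complex.I_sq

/-- The gradient estimate `abs_pd_le` applied to real and imaginary parts. Stating it through `∂_z
∂_z̄ = Δ / 4` allows iteration: for the successive `z`-derivatives of `u` this quantity is known
from the Toda equations. -/
theorem norm_dz_le {z₀ : ℂ} {s M N : ℝ} (hs : 0 < s) (hf : ContDiffOn ℝ ∞ f (ball z₀ s))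
    (hM : ∀ z ∈ ball z₀ s, ‖f z‖ ≤ M) (hN : ∀ z ∈ ball z₀ s, ‖dz (dzbar f) z‖ ≤ N) :
    ‖dz f z₀‖ ≤ 12 * M / s + 8 * N * s := by
  have hb := isOpen_ball (x := z₀) (ε := s)
  have hz₀ := mem_ball_self hs (x := z₀)
  have hΔ : ∀ z ∈ ball z₀ s, ‖(Δ f) z‖ ≤ 4 * N := fun z hz => by
    rw [laplacian_eq_dz_dzbar hf hb hz, norm_mul]
    have := hN z hz
    norm_num
    linarith
  have key : ∀ l : ℂ →L[ℝ] ℝ, (∀ w, |l w| ≤ ‖w‖) →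
      |l (pd 1 f z₀)| ≤ 6 * M / s + 4 * N * s ∧ |l (pd Complex.I f z₀)| ≤ 6 * M / s + 4 * N * s := by
    intro l hl
    have hp : ∀ v, pd v (l ∘ f) z₀ = l (pd v f z₀) := fun v => by
      simp only [pd]
      rw [(l.hasFDerivAt.comp z₀ (hf.diffAt hb hz₀).hasFDerivAt).fderiv]
      rfl
    have := abs_pd_le (w := l ∘ f) hs (l.contDiff.comp_contDiffOn hf)
      (fun z hz => (hl _).trans (hM z hz)) (fun z hz => by
        rw [((hf.contDiffAt (hb.mem_nhds hz)).of_le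
          (by simpa using ENat.LEInfty.out)).laplacian_CLM_comp_left]
        exact (hl _).trans (hΔ z hz))
    rwa [hp, hp] at this
  have hre := key Complex.reCLM Complex.abs_re_le_norm
  have him := key Complex.imCLM Complex.abs_im_le_norm
  simp only [Complex.reCLM_apply, Complex.imCLM_apply] at hre him
  have h1 := Complex.norm_le_abs_re_add_abs_im (pd 1 f z₀)
  have h2 := Complex.norm_le_abs_re_add_abs_im (pd Complex.I f z₀)
  have h3 : ‖dz f z₀‖ ≤ 1 / 2 * (‖pd 1 f z₀‖ + ‖pd Complex.I f z₀‖) := by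
    rw [dz, norm_mul]
    refine mul_le_mul (by norm_num) ((norm_sub_le _ _).trans ?_) (norm_nonneg _) (by norm_num)
    rw [norm_mul, Complex.norm_I, one_mul]
    rfl
  have h4 : 12 * M / s = 2 * (6 * M / s) := by ring
  linarith [hre.1, hre.2, him.1, him.2]

end Wirtinger

/-! ### The coefficients of the Toda operator and their holomorphy. -/

section ClassicalSolution

/-- A smooth solution of the `SU(3)` Toda system on `U`. -/
structure ClassicalSolution (U : Set ℂ) (u v : ℂ → ℝ) : Prop where
  isOpen : IsOpen U
  smooth_u : ContDiffOn ℝ ∞ u U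
  smooth_v : ContDiffOn ℝ ∞ v U
  eq_u : ∀ z ∈ U, (Δ u) z = -(4 * Real.exp (2 * u z - v z))
  eq_v : ∀ z ∈ U, (Δ v) z = -(4 * Real.exp (2 * v z - u z))

/-- The potential `u_{zz} + u_z v_z - u_z²`. -/
noncomputable def potX (u v : ℂ → ℝ) (z : ℂ) : ℂ :=
  dz (dzReal u) z + dzReal u z * dzReal v z - dzReal u z * dzReal u z

/-- The coefficient of `∂_z` in the Toda operator. -/
noncomputable def W2 (u v : ℂ → ℝ) (z : ℂ) : ℂ :=
  dz (dzReal v) z + potX u v z - dzReal v z * dzReal v z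

/-- The coefficient of order zero in the Toda operator. -/
noncomputable def W3 (u v : ℂ → ℝ) (z : ℂ) : ℂ := dz (potX u v) z - dzReal v z * potX u v z

/-- The exponential `exp (2u - v)` as a complex-valued function. -/
noncomputable def expC (u v : ℂ → ℝ) (z : ℂ) : ℂ := (Real.exp (2 * u z - v z) : ℝ)

namespace ClassicalSolution

variable {U : Set ℂ} {u v : ℂ → ℝ} {z : ℂ}

theorem symm (h : ClassicalSolution U u v) : ClassicalSolution U v u :=
  ⟨h.isOpen, h.smooth_v, h.smooth_u, h.eq_v, h.eq_u⟩

theorem mono (h : ClassicalSolution U u v) {V : Set ℂ} (hV : IsOpen V) (hVU : V ⊆ U) :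
    ClassicalSolution V u v :=
  ⟨hV, h.smooth_u.mono hVU, h.smooth_v.mono hVU, fun z hz => h.eq_u z (hVU hz),
    fun z hz => h.eq_v z (hVU hz)⟩

theorem smooth_ofReal (h : ClassicalSolution U u v) :
    ContDiffOn ℝ ∞ (fun z => (u z : ℂ)) U :=
  Complex.ofRealCLM.contDiff.comp_contDiffOn h.smooth_u

theorem smooth_dz {f : ℂ → ℂ} (hf : ContDiffOn ℝ ∞ f U) (hU : IsOpen U) :
    ContDiffOn ℝ ∞ (dz f) U := by
  rw [dz_eq_wirt]; exact hf.wirt hU _ _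

theorem smooth_dzReal (h : ClassicalSolution U u v) : ContDiffOn ℝ ∞ (dzReal u) U :=
  smooth_dz h.smooth_ofReal h.isOpen

theorem smooth_potX (h : ClassicalSolution U u v) : ContDiffOn ℝ ∞ (potX u v) U :=
  ((smooth_dz h.smooth_dzReal h.isOpen).add (h.smooth_dzReal.mul h.symm.smooth_dzReal)).sub
    (h.smooth_dzReal.mul h.smooth_dzReal)

theorem smooth_expC (h : ClassicalSolution U u v) : ContDiffOn ℝ ∞ (expC u v) U :=
  Complex.ofRealCLM.contDiff.comp_contDiffOn
    (((contDiffOn_const (c := (2 : ℝ))).mul h.smooth_u).sub h.smooth_v).exp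

theorem dz_dzbar_ofReal (h : ClassicalSolution U u v) (hz : z ∈ U) :
    dz (dzbar fun z => (u z : ℂ)) z = -expC u v z := by
  have h1 := laplacian_eq_dz_dzbar h.smooth_ofReal h.isOpen hz
  have h2 : (Δ fun z => (u z : ℂ)) z = ((Δ u) z : ℂ) :=
    ((h.smooth_u.contDiffAt (h.isOpen.mem_nhds hz)).of_le
      (by simpa using ENat.LEInfty.out)).laplacian_CLM_comp_left (l := Complex.ofRealCLM)
  rw [h2, h.eq_u z hz] at h1
  rw [expC]
  push_cast at h1 ⊢
  linear_combination -h1 / 4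

theorem dzbar_dzReal (h : ClassicalSolution U u v) (hz : z ∈ U) :
    dzbar (dzReal u) z = -expC u v z := by
  rw [← h.dz_dzbar_ofReal hz, dz_eq_wirt, dzReal, dz_eq_wirt, dzbar]
  exact wirt_comm h.smooth_ofReal h.isOpen hz _ _ _ _

theorem dz_expC (h : ClassicalSolution U u v) (hz : z ∈ U) :
    dz (expC u v) z = expC u v z * (2 * dzReal u z - dzReal v z) := by
  have hu := h.smooth_u.diffAt h.isOpen hz
  have hv := h.smooth_v.diffAt h.isOpen hz
  have h1 := Complex.ofRealCLM.hasFDerivAt.comp z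
    ((hu.hasFDerivAt.const_mul 2).sub hv.hasFDerivAt).exp
  have hu' := (Complex.ofRealCLM.hasFDerivAt.comp z hu.hasFDerivAt).fderiv
  have hv' := (Complex.ofRealCLM.hasFDerivAt.comp z hv.hasFDerivAt).fderiv
  have e1 : fderiv ℝ (expC u v) z = _ := h1.fderiv
  have e2 : fderiv ℝ (fun z => (u z : ℂ)) z = _ := hu'
  have e3 : fderiv ℝ (fun z => (v z : ℂ)) z = _ := hv'
  simp only [dz, dzReal, e1, e2, e3, expC]
  simp
  ring

theorem hasDz {f : ℂ → ℂ} (h : ClassicalSolution U u v) (hf : ContDiffOn ℝ ∞ f U) (hz : z ∈ U) :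
    HasWirt (1 / 2) (-Complex.I / 2) f (dz f z) z := by
  rw [dz_eq_wirt]; exact hasWirt hf h.isOpen hz _ _

theorem hasDzbar_dzReal (h : ClassicalSolution U u v) (hz : z ∈ U) :
    HasWirt (1 / 2) (Complex.I / 2) (dzReal u) (-expC u v z) z := by
  rw [← h.dzbar_dzReal hz]; exact hasWirt h.smooth_dzReal h.isOpen hz _ _

theorem dz_dzbar_dzReal (h : ClassicalSolution U u v) (hz : z ∈ U) :
    dz (dzbar (dzReal u)) z = -(expC u v z * (2 * dzReal u z - dzReal v z)) := by
  have := ((h.hasDz h.smooth_expC hz).const_mul (-1)).congr (g := dzbar (dzReal u)) h.isOpen hz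
    fun w hw => by rw [h.dzbar_dzReal hw]; ring
  rw [← h.dz_expC hz, this.dz_eq]; ring

theorem dzbar_dz_dzReal (h : ClassicalSolution U u v) (hz : z ∈ U) :
    dzbar (dz (dzReal u)) z = -(expC u v z * (2 * dzReal u z - dzReal v z)) := by
  rw [← h.dz_dzbar_dzReal hz, dz_eq_wirt, dzbar]
  exact wirt_comm h.smooth_dzReal h.isOpen hz _ _ _ _

theorem dz_dzbar_dz_dzReal (h : ClassicalSolution U u v) (hz : z ∈ U) :
    dz (dzbar (dz (dzReal u))) z = -(expC u v z * ((2 * dzReal u z - dzReal v z) ^ 2 +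
      (2 * dz (dzReal u) z - dz (dzReal v) z))) := by
  have h1 := (((h.hasDz h.smooth_dzReal hz).const_mul 2).sub
    (h.hasDz h.symm.smooth_dzReal hz))
  have h2 := ((h.hasDz h.smooth_expC hz).mul h1).const_mul (-1)
  have := h2.congr (g := dzbar (dz (dzReal u))) h.isOpen hz
    fun w hw => by rw [h.dzbar_dz_dzReal hw]; ring
  rw [this.dz_eq, h.dz_expC hz]; ring

theorem hasDzbar_dz_dzReal (h : ClassicalSolution U u v) (hz : z ∈ U) :
    HasWirt (1 / 2) (Complex.I / 2) (dz (dzReal u))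
      (-(expC u v z * (2 * dzReal u z - dzReal v z))) z := by
  rw [← h.dzbar_dz_dzReal hz]
  exact hasWirt (smooth_dz h.smooth_dzReal h.isOpen) h.isOpen hz _ _

/-- The terms containing `exp (2u - v)` cancel, and only `∂_z̄ v_z` contributes. -/
theorem hasDzbar_potX (h : ClassicalSolution U u v) (hz : z ∈ U) :
    HasWirt (1 / 2) (Complex.I / 2) (potX u v) (-(dzReal u z * expC v u z)) z := by
  have hu := h.hasDzbar_dzReal hz
  have := ((h.hasDzbar_dz_dzReal hz).add (hu.mul (h.symm.hasDzbar_dzReal hz))).sub (hu.mul hu)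
  refine ⟨this.1, this.2.trans ?_⟩
  ring

/-- With `q = exp (2v - u)`, the three summands have `∂_z̄` equal to `-q (2v_z - u_z)`, `-u_z q` and
`2 v_z q`, which add up to zero. -/
theorem differentiableOn_W2 (h : ClassicalSolution U u v) : DifferentiableOn ℂ (W2 u v) U := by
  intro z hz
  have hv := h.symm.hasDzbar_dzReal hz
  have := ((h.symm.hasDzbar_dz_dzReal hz).add (h.hasDzbar_potX hz)).sub (hv.mul hv)
  refine (differentiableAt_of_dzbar_eq_zero ⟨this.1, this.2.trans ?_⟩).differentiableWithinAt
  ring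

/-- Commuting `∂_z̄` past `∂_z` reduces to the formula for `∂_z̄` of `potX`; the resulting multiple
of `exp (2v - u)` vanishes by the definition of `potX`. -/
theorem differentiableOn_W3 (h : ClassicalSolution U u v) : DifferentiableOn ℂ (W3 u v) U := by
  intro z hz
  have h1 : HasWirt (1 / 2) (Complex.I / 2) (dz (potX u v))
      (-(dz (dzReal u) z * expC v u z + dzReal u z * dz (expC v u) z)) z := by
    have e := wirt_comm h.smooth_potX h.isOpen hz (1 / 2) (Complex.I / 2) (1 / 2) (-Complex.I / 2)
    have h2 := ((((h.hasDz h.smooth_dzReal hz).mul (h.hasDz h.symm.smooth_expC hz)).const_mul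
      (-1)).congr (g := dzbar (potX u v)) h.isOpen hz
        fun w hw => (h.hasDzbar_potX hw).2.trans (by ring)).2
    refine ⟨(smooth_dz h.smooth_potX h.isOpen).diffAt h.isOpen hz, ?_⟩
    rw [dz_eq_wirt] at h2 ⊢
    rw [e]
    exact h2.trans (by ring)
  have := h1.sub ((h.symm.hasDzbar_dzReal hz).mul (h.hasDzbar_potX hz))
  refine (differentiableAt_of_dzbar_eq_zero ⟨this.1, this.2.trans ?_⟩).differentiableWithinAt
  rw [h.symm.dz_expC hz, potX]
  ring

theorem todaOperator_eq (h : ClassicalSolution U u v) {y : ℂ → ℂ} (hy : ContDiffOn ℝ ∞ y U)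
    (hz : z ∈ U) :
    todaOperator u v y z = dz (dz (dz y)) z + W2 u v z * dz y z + W3 u v z * y z := by
  have hy1 := smooth_dz hy h.isOpen
  have hy2 := smooth_dz hy1 h.isOpen
  -- The two inner factors multiply to `∂_z² + v_z ∂_z + potX`. The equality is needed on all of
  -- `U`, since it is differentiated once more.
  have e1 : EqOn (dzAdd (fun z => dzReal v z - dzReal u z) (dzAdd (fun z => dzReal u z) y))
      (fun z => dz (dz y) z + dzReal v z * dz y z + potX u v z * y z) U := by
    intro w hw
    have := ((h.hasDz hy1 hw).add ((h.hasDz h.smooth_dzReal hw).mul (h.hasDz hy hw))).dz_eq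
    have e : (fun z => dz y z + dzReal u z * y z) = dzAdd (fun z => dzReal u z) y := rfl
    rw [e] at this
    rw [dzAdd, this, dzAdd]
    simp only [potX]
    ring
  have h2 := ((((h.hasDz hy2 hz).add ((h.hasDz h.symm.smooth_dzReal hz).mul (h.hasDz hy1 hz))).add
    ((h.hasDz h.smooth_potX hz).mul (h.hasDz hy hz))).congr h.isOpen hz e1).dz_eq
  rw [todaOperator, dzAdd, h2, e1 hz, W2, W3]
  ring

end ClassicalSolution

end ClassicalSolution

/-! ### Derivative bounds for solutions on a disc. -/

namespace ClassicalSolution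

variable {u v : ℂ → ℝ} {z₀ z : ℂ} {s T : ℝ}

theorem norm_expC (u v : ℂ → ℝ) (z : ℂ) : ‖expC u v z‖ = Real.exp (2 * u z - v z) := by
  rw [expC, Complex.norm_real, Real.norm_of_nonneg (Real.exp_nonneg _)]

theorem norm_two_mul_sub_le {a b : ℂ} {M : ℝ} (ha : ‖a‖ ≤ M) (hb : ‖b‖ ≤ M) :
    ‖2 * a - b‖ ≤ 3 * M := by
  refine (norm_sub_le _ _).trans ?_
  rw [norm_mul]
  norm_num
  linarith

theorem ball_subset_ball_of_mem {r t : ℝ} (hz : z ∈ ball z₀ r) (hrt : r + t ≤ s) :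
    ball z t ⊆ ball z₀ s :=
  ball_subset_ball' (by rw [mem_ball] at hz; linarith)

/-- `T` scales like an inverse length. With `|u| ≤ T s` and `exp (2u - v) ≤ T / s`, every
`z`-derivative of `u` costs one factor `T`. The two lemmas after this one continue the iteration, on
smaller concentric discs, and use `1 ≤ T s` to absorb `T / s` into `T²`. -/
theorem norm_dzReal_le (h : ClassicalSolution (ball z₀ s) u v) (hs : 0 < s)
    (hu : ∀ z ∈ ball z₀ s, |u z| ≤ T * s)
    (hp : ∀ z ∈ ball z₀ s, Real.exp (2 * u z - v z) ≤ T / s) (hz : z ∈ ball z₀ (s / 2)) :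
    ‖dzReal u z‖ ≤ 28 * T := by
  have hsub : ball z (s / 2) ⊆ ball z₀ s := ball_subset_ball_of_mem hz (by linarith)
  have := norm_dz_le (half_pos hs) (h.smooth_ofReal.mono hsub) (M := T * s) (N := T / s)
    (fun w hw => by
      rw [Complex.norm_real, Real.norm_eq_abs]; exact hu w (hsub hw))
    (fun w hw => by
      rw [h.dz_dzbar_ofReal (hsub hw), norm_neg, norm_expC]; exact hp w (hsub hw))
  refine this.trans (le_of_eq ?_)
  field_simp
  ring

theorem norm_dz_dzReal_le (h : ClassicalSolution (ball z₀ s) u v) (hs : 0 < s) (hT : 1 ≤ T * s)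
    (hu : ∀ z ∈ ball z₀ s, |u z| ≤ T * s) (hv : ∀ z ∈ ball z₀ s, |v z| ≤ T * s)
    (hp : ∀ z ∈ ball z₀ s, Real.exp (2 * u z - v z) ≤ T / s)
    (hq : ∀ z ∈ ball z₀ s, Real.exp (2 * v z - u z) ≤ T / s) (hz : z ∈ ball z₀ (s / 4)) :
    ‖dz (dzReal u) z‖ ≤ 1512 * T ^ 2 := by
  have hT0 : 0 < T := pos_of_mul_pos_left (one_pos.trans_le hT) hs.le
  have hsub : ball z (s / 4) ⊆ ball z₀ (s / 2) := ball_subset_ball_of_mem hz (by linarith)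
  have hsub' : ball z₀ (s / 2) ⊆ ball z₀ s := ball_subset_ball (by linarith)
  have := norm_dz_le (show 0 < s / 4 by positivity)
    (h.smooth_dzReal.mono (hsub.trans hsub')) (M := 28 * T) (N := T / s * (3 * (28 * T)))
    (fun w hw => h.norm_dzReal_le hs hu hp (hsub hw))
    (fun w hw => by
      rw [h.dz_dzbar_dzReal (hsub' (hsub hw)), norm_neg, norm_mul, norm_expC]
      exact mul_le_mul (hp w (hsub' (hsub hw))) (norm_two_mul_sub_le
        (h.norm_dzReal_le hs hu hp (hsub hw)) (h.symm.norm_dzReal_le hs hv hq (hsub hw)))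
        (norm_nonneg _) (by positivity))
  refine this.trans ?_
  have h1 : T / s ≤ T ^ 2 := by
    rw [div_le_iff₀ hs]; nlinarith
  have h2 : 12 * (28 * T) / (s / 4) + 8 * (T / s * (3 * (28 * T))) * (s / 4) =
      1344 * (T / s) + 168 * T ^ 2 := by
    field_simp; ring
  linarith

theorem norm_dz_dz_dzReal_le (h : ClassicalSolution (ball z₀ s) u v) (hs : 0 < s) (hT : 1 ≤ T * s)
    (hu : ∀ z ∈ ball z₀ s, |u z| ≤ T * s) (hv : ∀ z ∈ ball z₀ s, |v z| ≤ T * s)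
    (hp : ∀ z ∈ ball z₀ s, Real.exp (2 * u z - v z) ≤ T / s)
    (hq : ∀ z ∈ ball z₀ s, Real.exp (2 * v z - u z) ≤ T / s) :
    ‖dz (dz (dzReal u)) z₀‖ ≤ 95760 * T ^ 3 := by
  have hT0 : 0 < T := pos_of_mul_pos_left (one_pos.trans_le hT) hs.le
  have hsub : ball z₀ (s / 4) ⊆ ball z₀ (s / 2) := ball_subset_ball (by linarith)
  have hsub' : ball z₀ (s / 4) ⊆ ball z₀ s := ball_subset_ball (by linarith)
  have := norm_dz_le (show 0 < s / 4 by positivity)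
    ((smooth_dz h.smooth_dzReal h.isOpen).mono hsub') (M := 1512 * T ^ 2)
    (N := T / s * ((3 * (28 * T)) ^ 2 + 3 * (1512 * T ^ 2)))
    (fun w hw => h.norm_dz_dzReal_le hs hT hu hv hp hq hw)
    (fun w hw => by
      rw [h.dz_dzbar_dz_dzReal (hsub' hw), norm_neg, norm_mul, norm_expC]
      refine mul_le_mul (hp w (hsub' hw)) ((norm_add_le _ _).trans (add_le_add ?_ ?_))
        (norm_nonneg _) (by positivity)
      · rw [norm_pow]
        exact pow_le_pow_left₀ (norm_nonneg _) (norm_two_mul_sub_le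
          (h.norm_dzReal_le hs hu hp (hsub hw)) (h.symm.norm_dzReal_le hs hv hq (hsub hw))) 2
      · exact norm_two_mul_sub_le (h.norm_dz_dzReal_le hs hT hu hv hp hq hw)
          (h.symm.norm_dz_dzReal_le hs hT hv hu hq hp hw))
  refine this.trans ?_
  have h1 : T ^ 2 / s ≤ T ^ 3 := by
    rw [div_le_iff₀ hs]
    have := mul_le_mul_of_nonneg_left hT (sq_nonneg T)
    linarith
  have h2 : 12 * (1512 * T ^ 2) / (s / 4) +
      8 * (T / s * ((3 * (28 * T)) ^ 2 + 3 * (1512 * T ^ 2))) * (s / 4) =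
      72576 * (T ^ 2 / s) + 23184 * T ^ 3 := by
    field_simp; ring
  linarith

/-- Scale-invariant bounds for the coefficients of the Toda operator. -/
theorem norm_W_le {μ : ℝ} (h : ClassicalSolution (ball z₀ s) u v) (hs : 0 < s) (hμ : 1 ≤ μ)
    (hu : ∀ z ∈ ball z₀ s, |u z| ≤ μ) (hv : ∀ z ∈ ball z₀ s, |v z| ≤ μ)
    (hp : ∀ z ∈ ball z₀ s, Real.exp (2 * u z - v z) ≤ μ / s ^ 2)
    (hq : ∀ z ∈ ball z₀ s, Real.exp (2 * v z - u z) ≤ μ / s ^ 2) :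
    ‖W2 u v z₀‖ ≤ 6000 * (μ / s) ^ 2 ∧ ‖W3 u v z₀‖ ≤ 400000 * (μ / s) ^ 3 := by
  -- This makes `μ = T s` and `μ / s² = T / s`, the form required by the iterated derivative bounds.
  set T := μ / s with hT
  have hTs : T * s = μ := by rw [hT]; field_simp
  have hTs' : T / s = μ / s ^ 2 := by rw [hT]; field_simp
  have hT0 : 0 < T := by positivity
  rw [← hTs] at hu hv hμ
  rw [← hTs'] at hp hq
  have hz2 : z₀ ∈ ball z₀ (s / 2) := mem_ball_self (by positivity)
  have hz4 : z₀ ∈ ball z₀ (s / 4) := mem_ball_self (by positivity)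
  have a1 := h.norm_dzReal_le hs hu hp hz2
  have b1 := h.symm.norm_dzReal_le hs hv hq hz2
  have a2 := h.norm_dz_dzReal_le hs hμ hu hv hp hq hz4
  have b2 := h.symm.norm_dz_dzReal_le hs hμ hv hu hq hp hz4
  have a3 := h.norm_dz_dz_dzReal_le hs hμ hu hv hp hq
  have hmul : ∀ {x y : ℂ} {X Y : ℝ}, ‖x‖ ≤ X → ‖y‖ ≤ Y → ‖x * y‖ ≤ X * Y := by
    intro x y X Y hx hy
    rw [norm_mul]
    exact mul_le_mul hx hy (norm_nonneg _) ((norm_nonneg _).trans hx)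
  have hX : ‖potX u v z₀‖ ≤ 1512 * T ^ 2 + 28 * T * (28 * T) + 28 * T * (28 * T) :=
    norm_sub_le_of_le (norm_add_le_of_le a2 (hmul a1 b1)) (hmul a1 a1)
  have hz := mem_ball_self hs (x := z₀)
  have hdX : dz (potX u v) z₀ = dz (dz (dzReal u)) z₀ +
      (dz (dzReal u) z₀ * dzReal v z₀ + dzReal u z₀ * dz (dzReal v) z₀) -
      (dz (dzReal u) z₀ * dzReal u z₀ + dzReal u z₀ * dz (dzReal u) z₀) := by
    have ha := h.hasDz h.smooth_dzReal hz
    exact (((h.hasDz (smooth_dz h.smooth_dzReal h.isOpen) hz).add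
      (ha.mul (h.hasDz h.symm.smooth_dzReal hz))).sub (ha.mul ha)).dz_eq
  have hdX' : ‖dz (potX u v) z₀‖ ≤ 95760 * T ^ 3 + (1512 * T ^ 2 * (28 * T) +
      28 * T * (1512 * T ^ 2)) + (1512 * T ^ 2 * (28 * T) + 28 * T * (1512 * T ^ 2)) := by
    rw [hdX]
    exact norm_sub_le_of_le (norm_add_le_of_le a3 (norm_add_le_of_le (hmul a2 b1) (hmul a1 b2)))
      (norm_add_le_of_le (hmul a2 a1) (hmul a1 a2))
  constructor
  · refine (norm_sub_le_of_le (norm_add_le_of_le b2 hX) (hmul b1 b1)).trans ?_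
    nlinarith [sq_nonneg T]
  · refine (norm_sub_le_of_le hdX' (hmul b1 hX)).trans ?_
    have : 0 < T ^ 3 := by positivity
    nlinarith

end ClassicalSolution

/-! ### Liouville's theorem and removable singularities. -/

section EntireFunctions

/-- An entire function which is `o(z ^ (n + 1))` at infinity is a polynomial of degree `≤ n`. -/
theorem exists_eq_sum_of_isLittleO {G : ℂ → ℂ} (hG : Differentiable ℂ G) {n : ℕ}
    (hO : G =o[Bornology.cobounded ℂ] fun z => z ^ (n + 1)) :
    ∃ c : ℕ → ℂ, ∀ z, G z = ∑ k ∈ Finset.range (n + 1), c k * z ^ k := by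
  -- Cauchy's estimate on a large circle: there `|G| ≤ (ε / k!) R ^ k`, so the `k`-th derivative at
  -- `0` has norm at most `ε`.
  have hzero : ∀ k, n + 1 ≤ k → iteratedDeriv k G 0 = 0 := by
    intro k hk
    rw [← norm_le_zero_iff]
    refine le_of_forall_pos_le_add fun ε hε => ?_
    have hf : (0 : ℝ) < k.factorial := by positivity
    have h1 := hO.def (div_pos hε hf)
    rw [← comap_norm_atTop, eventually_comap] at h1
    obtain ⟨R, hR1, hR⟩ := ((eventually_ge_atTop (1 : ℝ)).and h1).exists
    have hR0 : 0 < R := by linarith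
    have h2 := Complex.norm_iteratedDeriv_le_of_forall_mem_sphere_norm_le (f := G) (c := 0)
      (C := ε / k.factorial * R ^ k) k hR0 hG.diffContOnCl (fun z hz => by
        have hzR : ‖z‖ = R := by simpa using hz
        refine (hR z hzR).trans ?_
        rw [norm_pow, hzR]
        gcongr)
    refine h2.trans (le_of_eq ?_)
    field_simp
    ring
  refine ⟨fun k => (k.factorial : ℂ)⁻¹ * iteratedDeriv k G 0, fun z => ?_⟩
  rw [← Complex.taylorSeries_eq_of_entire' 0 z hG, tsum_eq_sum (s := Finset.range (n + 1))]
  · simp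
  · intro k hk
    rw [hzero k (by simpa using hk)]
    simp

/-- Riemann's removable singularity theorem, applied at `0` and then at `1`. The values of `f` at
these two points are arbitrary; subtracting them is harmless because constants are `o((z - p)⁻¹)`.
-/
theorem exists_differentiable_eqOn {f : ℂ → ℂ} (hf : DifferentiableOn ℂ f {0, 1}ᶜ)
    (h0 : f =o[𝓝[≠] 0] fun z => (z - 0)⁻¹) (h1 : f =o[𝓝[≠] 1] fun z => (z - 1)⁻¹) :
    ∃ G : ℂ → ℂ, Differentiable ℂ G ∧ EqOn G f {0, 1}ᶜ := by
  have hconst : ∀ (p a : ℂ), (fun _ : ℂ => a) =o[𝓝[≠] p] fun z => (z - p)⁻¹ := by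
    intro p a
    refine Asymptotics.isLittleO_const_left.2 (Or.inr ?_)
    have : Tendsto (fun z : ℂ => z - p) (𝓝[≠] p) (𝓝[≠] 0) := by
      refine tendsto_nhdsWithin_of_tendsto_nhds_of_eventually_within _ ?_ ?_
      · refine tendsto_nhdsWithin_of_tendsto_nhds ?_
        have : Tendsto (fun z : ℂ => z - p) (𝓝 p) (𝓝 (p - p)) :=
          (continuous_id.sub continuous_const).tendsto p
        rwa [sub_self] at this
      · filter_upwards [self_mem_nhdsWithin] with z hz using sub_ne_zero.2 hz
    exact tendsto_norm_cobounded_atTop.comp (tendsto_inv₀_nhdsNE_zero.comp this)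
  set g := Function.update f 0 (limUnder (𝓝[≠] (0 : ℂ)) f) with hg
  have hgf : ∀ z, z ≠ 0 → g z = f z := fun z hz => Function.update_of_ne hz _ _
  have hg1 : DifferentiableOn ℂ g {1}ᶜ :=
    Complex.differentiableOn_update_limUnder_of_isLittleO
      (isOpen_compl_singleton.mem_nhds (by simp))
      (hf.mono fun z hz => by
        simp only [mem_compl_iff, mem_insert_iff, mem_singleton_iff, not_or]
        exact ⟨hz.2, hz.1⟩) (h0.sub (hconst 0 _))
  have hg1' : g =o[𝓝[≠] 1] fun z => (z - 1)⁻¹ := by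
    refine h1.congr' ?_ EventuallyEq.rfl
    filter_upwards [mem_nhdsWithin_of_mem_nhds
      (isOpen_compl_singleton.mem_nhds (show (1 : ℂ) ∈ ({0} : Set ℂ)ᶜ by simp))] with z hz
    exact (hgf z hz).symm
  refine ⟨Function.update g 1 (limUnder (𝓝[≠] (1 : ℂ)) g), ?_, ?_⟩
  · rw [← differentiableOn_univ]
    exact Complex.differentiableOn_update_limUnder_of_isLittleO univ_mem
      (hg1.mono fun z hz => hz.2) (hg1'.sub (hconst 1 _))
  · intro z hz
    simp only [mem_compl_iff, mem_insert_iff, mem_singleton_iff, not_or] at hz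
    rw [Function.update_of_ne hz.2, hgf z hz.1]

end EntireFunctions

/-! ### Growth of the coefficients at the sources and at infinity. -/

namespace ClassicalSolution

variable {u v : ℂ → ℝ} {U : Set ℂ} {p z : ℂ}

theorem smooth_exp (h : ClassicalSolution U u v) :
    ContDiffOn ℝ ∞ (fun z => Real.exp (2 * u z - v z)) U :=
  (((contDiffOn_const (c := (2 : ℝ))).mul h.smooth_u).sub h.smooth_v).exp

/-- With `h = 2u - v`, `Δ exp h = exp h (|∇h|² + Δh)`, and the system gives `Δh = -8 exp h + 4 exp
(2v - u) ≥ -8 exp h`. -/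
theorem laplacian_exp_ge (h : ClassicalSolution U u v) (hz : z ∈ U) :
    -(8 * Real.exp (2 * u z - v z) ^ 2) ≤ (Δ fun z => Real.exp (2 * u z - v z)) z := by
  have hU := h.isOpen
  set F : ℂ → ℝ := fun z => Real.exp (2 * u z - v z) with hF
  have e1 : ∀ w, EqOn (pd w F) (fun z => F z * (2 * pd w u z - pd w v z)) U := by
    intro w z hz
    have := (((h.smooth_u.diffAt hU hz).hasFDerivAt.const_mul 2).sub
      (h.smooth_v.diffAt hU hz).hasFDerivAt).exp.fderiv
    simp only [Pi.sub_apply] at this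
    simp only [pd, hF]
    rw [this]
    simp
  have e2 : ∀ w, pd w (pd w F) z =
      F z * ((2 * pd w u z - pd w v z) ^ 2 + (2 * pd w (pd w u) z - pd w (pd w v) z)) := by
    intro w
    rw [pd_congr hU (e1 w) w hz, pd]
    have hu := ((h.smooth_u.pd hU w).diffAt hU hz)
    have hv := ((h.smooth_v.pd hU w).diffAt hU hz)
    have hd : DifferentiableAt ℝ (fun z => 2 * pd w u z - pd w v z) z := (hu.const_mul 2).sub hv
    rw [fderiv_fun_mul (h.smooth_exp.diffAt hU hz) hd,
      fderiv_fun_sub (hu.const_mul 2) hv, fderiv_const_mul hu]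
    have := e1 w hz
    rw [pd] at this
    simp only [add_apply, smul_apply, sub_apply, smul_eq_mul]
    rw [this]
    simp only [pd]
    ring
  rw [laplacian_eq_pd h.smooth_exp hU hz, e2, e2]
  have eu := h.eq_u z hz
  have ev := h.eq_v z hz
  rw [laplacian_eq_pd h.smooth_u hU hz] at eu
  rw [laplacian_eq_pd h.smooth_v hU hz] at ev
  have hF0 : 0 < F z := Real.exp_pos _
  have hq0 : 0 < Real.exp (2 * v z - u z) := Real.exp_pos _
  have h1 : -(8 * F z) ≤ (2 * pd 1 u z - pd 1 v z) ^ 2 + (2 * pd 1 (pd 1 u) z - pd 1 (pd 1 v) z) +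
      ((2 * pd Complex.I u z - pd Complex.I v z) ^ 2 +
        (2 * pd Complex.I (pd Complex.I u) z - pd Complex.I (pd Complex.I v) z)) := by
    have : F z = Real.exp (2 * u z - v z) := rfl
    nlinarith [sq_nonneg (2 * pd 1 u z - pd 1 v z),
      sq_nonneg (2 * pd Complex.I u z - pd Complex.I v z)]
  have h2 := mul_le_mul_of_nonneg_left h1 hF0.le
  have h3 : Real.exp (2 * u z - v z) = F z := rfl
  rw [h3]
  linarith

/-- The discs shrink to a point, which is a null set, so the integrals tend to zero. -/
theorem exists_ball_integral_le {f : ℂ → ℝ} (hf : LocallyIntegrable f) (p : ℂ) {ε : ℝ}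
    (hε : 0 < ε) : ∃ ρ : ℝ, 0 < ρ ∧ ρ ≤ 1 ∧ ∫ x in ball p ρ, f x ≤ ε := by
  have hpos : ∀ n : ℕ, (0 : ℝ) < 1 / ((n : ℝ) + 1) := fun n => Nat.one_div_pos_of_nat
  have hanti : Antitone fun n : ℕ => ball p (1 / ((n : ℝ) + 1)) := fun m n hmn =>
    ball_subset_ball (Nat.one_div_le_one_div hmn)
  have h1 := tendsto_setIntegral_of_antitone (μ := volume) (f := f)
    (s := fun n : ℕ => ball p (1 / ((n : ℝ) + 1))) (fun n => measurableSet_ball) hanti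
    ⟨0, (hf.integrableOn_isCompact (isCompact_closedBall p _)).mono_set ball_subset_closedBall⟩
  have h2 : ⋂ n : ℕ, ball p (1 / ((n : ℝ) + 1)) = {p} := by
    ext x
    simp only [mem_iInter, mem_ball, mem_singleton_iff]
    constructor
    · intro hx
      by_contra hne
      obtain ⟨n, hn⟩ := exists_nat_one_div_lt (dist_pos.2 hne)
      exact absurd (hx n) (not_lt.2 hn.le)
    · rintro rfl n
      rw [dist_self]; exact hpos n
  rw [h2] at h1
  simp only [integral_singleton, measureReal_def, measure_singleton, ENNReal.toReal_zero,
    zero_smul] at h1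
  obtain ⟨n, hn⟩ := (h1.eventually (gt_mem_nhds hε)).exists
  refine ⟨_, hpos n, ?_, hn.le⟩
  rw [div_le_one (by positivity)]
  linarith [show (0 : ℝ) ≤ n from n.cast_nonneg]

theorem ball_subset_punctured {z : ℂ} {t : ℝ} (ht : t ≤ ‖z - p‖) (hz : ‖z - p‖ + t ≤ 1) :
    ball z t ⊆ ball p 1 \ {p} := fun w hw => by
  rw [mem_ball] at hw
  rw [← dist_eq_norm] at ht hz
  refine ⟨mem_ball.2 ?_, ?_⟩
  · have := dist_triangle w z p
    linarith
  · rintro rfl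
    rw [dist_comm] at hw
    linarith

/-- Integrability of `exp (2u - v)` forces it to be at most quadratically singular at `p`. -/
theorem exists_exp_le (h : ClassicalSolution (ball p 1 \ {p}) u v)
    (he : LocallyIntegrable fun z => Real.exp (2 * u z - v z)) :
    ∃ C ρ : ℝ, 0 < C ∧ 0 < ρ ∧ ρ ≤ 1 ∧
      ∀ z, z ≠ p → ‖z - p‖ < ρ → Real.exp (2 * u z - v z) ≤ C / ‖z - p‖ ^ 2 := by
  obtain ⟨ε, C, hε, hC, hreg⟩ := exists_epsilon_regularity
  obtain ⟨ρ, hρ, hρ1, hint⟩ := exists_ball_integral_le he p hε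
  refine ⟨4 * C, ρ / 2, by positivity, by positivity, by linarith, fun z hz hzρ => ?_⟩
  have hr : 0 < ‖z - p‖ := norm_pos_iff.2 (sub_ne_zero.2 hz)
  have hsub : ball z (3 / 4 * ‖z - p‖) ⊆ ball p 1 \ {p} :=
    ball_subset_punctured (by linarith) (by linarith)
  have hmono : ∫ x in ball z (‖z - p‖ / 2), Real.exp (2 * u x - v x) ≤
      ∫ x in ball p ρ, Real.exp (2 * u x - v x) := by
    refine setIntegral_mono_set ?_ (Eventually.of_forall fun x => (Real.exp_pos _).le)
      (LE.le.eventuallyLE ?_)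
    · exact (he.integrableOn_isCompact (isCompact_closedBall p ρ)).mono_set ball_subset_closedBall
    · refine ball_subset_ball' ?_
      rw [dist_eq_norm]; linarith
  -- At radius `|z - p| / 2` ε-regularity reads `F z * |z - p|² / 4 ≤ C`, whence the constant `4 *
  -- C`.
  have := hreg (fun z => Real.exp (2 * u z - v z)) z (‖z - p‖ / 2) (3 / 4 * ‖z - p‖)
    (by positivity) (by linarith) (h.smooth_exp.mono hsub) (fun w _ => Real.exp_pos _)
    (fun w hw => h.laplacian_exp_ge (hsub hw)) (hmono.trans hint)
  rw [le_div_iff₀ (by positivity)]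
  linarith

/-- Here `m ^ 4` is the distance to a source, so the logarithm is traded for a quarter power of the
distance. The fourth root is fine enough: `W3` involves up to three such factors and thus loses only
three quarters of a power. -/
theorem one_sub_log_le {m x : ℝ} (hm : 0 < m) (hx : m ^ 4 / 2 ≤ x) : 1 - Real.log x ≤ 4 / m := by
  have h1 : Real.log (m ^ 4 / 2) ≤ Real.log x := Real.log_le_log (by positivity) hx
  rw [Real.log_div (by positivity) (by norm_num), Real.log_pow] at h1
  have h2 := Real.log_le_sub_one_of_pos (inv_pos.2 hm)
  rw [Real.log_inv] at h2
  have h3 := Real.log_two_lt_d9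
  rw [div_eq_mul_inv]
  push_cast at h1
  linarith

theorem exists_exp_le_of_bound {C ρ : ℝ} (hC : 0 < C)
    (hb : ∀ z, z ≠ p → ‖z - p‖ < ρ → Real.exp (2 * u z - v z) ≤ C / ‖z - p‖ ^ 2) {s : ℝ}
    (hs : 0 < s) {w : ℂ} (hw1 : s ≤ ‖w - p‖) (hw2 : ‖w - p‖ < ρ) :
    Real.exp (2 * u w - v w) ≤ C / s ^ 2 := by
  refine (hb w ?_ hw2).trans ?_
  · rintro rfl
    rw [sub_self, norm_zero] at hw1
    linarith
  · gcongr

/-- The weak form near `p` of an equation with a point source of strength `γ` at `p`. -/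
def WeakNear (p : ℂ) (γ : ℝ) (u h : ℂ → ℝ) : Prop :=
  ∀ φ : ℂ → ℝ, ContDiff ℝ ∞ φ → HasCompactSupport φ → tsupport φ ⊆ ball p 1 →
    (∫ z, u z * (Δ φ) z) + (∫ z, 4 * Real.exp (h z) * φ z) = 4 * Real.pi * (γ * φ p)

theorem exists_abs_le (h : ClassicalSolution (ball p 1 \ {p}) u v) (hu : LocallyIntegrable u)
    (he : LocallyIntegrable fun z => Real.exp (2 * u z - v z)) {γ : ℝ}
    (hw : WeakNear p γ u fun z => 2 * u z - v z) :
    ∃ C ρ : ℝ, 0 < C ∧ 0 < ρ ∧ ρ ≤ 1 ∧ ∀ z, z ≠ p → ‖z - p‖ < ρ →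
      |u z| ≤ C * (1 - Real.log ‖z - p‖) ∧ Real.exp (2 * u z - v z) ≤ C / ‖z - p‖ ^ 2 := by
  obtain ⟨C, ρ, hC, hρ, hρ1, hb⟩ := h.exists_exp_le he
  obtain ⟨C', ρ', hC', hρ', hρ1', hb'⟩ := exists_abs_le_log h.smooth_u hu he hw hρ
    (show 0 ≤ 4 * C by positivity) (fun z hz hzρ => by
      rw [h.eq_u z ⟨by rw [mem_ball, dist_eq_norm]; linarith, hz⟩, abs_neg,
        abs_of_nonneg (by positivity), mul_div_assoc]
      exact mul_le_mul_of_nonneg_left (hb z hz hzρ) (by norm_num))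
  refine ⟨max C C', min ρ ρ', by positivity, by positivity, (min_le_left _ _).trans hρ1, ?_⟩
  intro z hz hzρ
  have h1 := hzρ.trans_le (min_le_left _ _)
  have h2 := hzρ.trans_le (min_le_right _ _)
  have hl : Real.log ‖z - p‖ ≤ 0 := Real.log_nonpos (norm_nonneg _) (by linarith)
  constructor
  · exact (hb' z hz h2).trans (mul_le_mul_of_nonneg_right (le_max_right _ _) (by linarith))
  · refine (hb z hz h1).trans ?_
    gcongr
    exact le_max_left _ _

/-- Growth of the coefficients of the Toda operator at a point source. -/
theorem exists_norm_W_le_near (h : ClassicalSolution (ball p 1 \ {p}) u v)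
    (hu : LocallyIntegrable u) (hv : LocallyIntegrable v)
    (he : LocallyIntegrable fun z => Real.exp (2 * u z - v z))
    (he' : LocallyIntegrable fun z => Real.exp (2 * v z - u z)) {γ γ' : ℝ}
    (hw : WeakNear p γ u fun z => 2 * u z - v z) (hw' : WeakNear p γ' v fun z => 2 * v z - u z) :
    ∃ K ρ : ℝ, 0 < ρ ∧ ∀ z m, 0 < m → ‖z - p‖ = m ^ 4 → m < ρ →
      ‖W2 u v z‖ ≤ K / m ^ 10 ∧ ‖W3 u v z‖ ≤ K / m ^ 15 := by
  obtain ⟨C₁, ρ₁, hC₁, hρ₁, hρ1₁, hb₁⟩ := h.exists_abs_le hu he hw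
  obtain ⟨C₂, ρ₂, hC₂, hρ₂, hρ1₂, hb₂⟩ := h.symm.exists_abs_le hv he' hw'
  set K := 4 * (C₁ + C₂ + 1) with hK
  have hK0 : 0 < K := by positivity
  refine ⟨6000 * (2 * K) ^ 2 + 400000 * (2 * K) ^ 3, min ρ₁ ρ₂ / 2, by positivity, ?_⟩
  intro z m hm hzm hmρ
  have hm1 : m < ρ₁ / 2 := by have := min_le_left ρ₁ ρ₂; linarith
  have hm2 : m < ρ₂ / 2 := by have := min_le_right ρ₁ ρ₂; linarith
  have hm4 : m ^ 4 ≤ m := pow_le_of_le_one hm.le (by linarith) (by norm_num)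
  have hs : 0 < m ^ 4 / 2 := by positivity
  have hdist : ∀ w ∈ ball z (m ^ 4 / 2), m ^ 4 / 2 ≤ ‖w - p‖ ∧ ‖w - p‖ < 2 * m := by
    intro w hw
    rw [mem_ball] at hw
    rw [← dist_eq_norm] at hzm ⊢
    have h1 := dist_triangle w z p
    have h2 := dist_triangle z w p
    rw [dist_comm z w] at h2
    constructor <;> linarith
  have hne : ∀ w ∈ ball z (m ^ 4 / 2), w ≠ p := fun w hw hwp => by
    have := (hdist w hw).1
    rw [hwp, sub_self, norm_zero] at this
    linarith
  have hKm : 1 ≤ K / m := by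
    rw [le_div_iff₀ hm]; linarith
  have hCK₁ : C₁ * (4 / m) ≤ K / m := by
    rw [mul_div_assoc']; gcongr; linarith
  have hCK₂ : C₂ * (4 / m) ≤ K / m := by
    rw [mul_div_assoc']; gcongr; linarith
  have hKK : K ≤ K / m := by
    rw [le_div_iff₀ hm]; nlinarith
  -- Radius `s = m ^ 4 / 2` and size `μ = K / m` give `μ / s = 2K / m ^ 5`, whose square and cube
  -- are the exponents 10 and 15.
  have hbound := (h.mono (isOpen_ball (x := z) (ε := m ^ 4 / 2))
    (ball_subset_punctured (by linarith) (by linarith))).norm_W_le hs hKm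
    (fun w hw => ((hb₁ w (hne w hw) (by linarith [(hdist w hw).2])).1.trans
      (mul_le_mul_of_nonneg_left (one_sub_log_le hm (hdist w hw).1) hC₁.le)).trans hCK₁)
    (fun w hw => ((hb₂ w (hne w hw) (by linarith [(hdist w hw).2])).1.trans
      (mul_le_mul_of_nonneg_left (one_sub_log_le hm (hdist w hw).1) hC₂.le)).trans hCK₂)
    (fun w hw => (exists_exp_le_of_bound hC₁ (fun z hz hzρ => (hb₁ z hz hzρ).2) hs (hdist w hw).1
      (by linarith [(hdist w hw).2])).trans (by gcongr; linarith))
    (fun w hw => (exists_exp_le_of_bound hC₂ (fun z hz hzρ => (hb₂ z hz hzρ).2) hs (hdist w hw).1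
      (by linarith [(hdist w hw).2])).trans (by gcongr; linarith))
  constructor
  · refine hbound.1.trans ?_
    have : 6000 * (K / m / (m ^ 4 / 2)) ^ 2 = 6000 * (2 * K) ^ 2 / m ^ 10 := by
      field_simp
    rw [this]
    gcongr
    linarith [show 0 < 400000 * (2 * K) ^ 3 by positivity]
  · refine hbound.2.trans ?_
    have : 400000 * (K / m / (m ^ 4 / 2)) ^ 3 = 400000 * (2 * K) ^ 3 / m ^ 15 := by
      field_simp
    rw [this]
    gcongr
    linarith [show 0 < 6000 * (2 * K) ^ 2 by positivity]

theorem exists_log_bound_at_infinity {γ : ℝ} (hu : LogAsymptoticAtInfinity γ u) :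
    ∃ C R : ℝ, 0 < C ∧ ∀ z, R ≤ ‖z‖ → |u z - (-2 * γ * Real.log ‖z‖)| ≤ C := by
  obtain ⟨C, hC, hb⟩ := hu.exists_pos
  rw [Asymptotics.isBigOWith_iff, ← comap_norm_atTop, eventually_comap, eventually_atTop] at hb
  obtain ⟨R, hR⟩ := hb
  exact ⟨C, R, hC, fun z hz => by simpa using hR _ hz z rfl⟩

/-- The exponent `2u - v` is `-2 (2γ - γ') log |z| + O(1)`, so the condition at infinity is what
yields the scale-invariant decay `|z|⁻²`. -/
theorem exp_le_at_infinity {γ γ' C s : ℝ} (hγ : 1 < 2 * γ - γ') (hs : 1 ≤ s) (hz : s ≤ ‖z‖)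
    (hu : |u z - (-2 * γ * Real.log ‖z‖)| ≤ C) (hv : |v z - (-2 * γ' * Real.log ‖z‖)| ≤ C) :
    Real.exp (2 * u z - v z) ≤ Real.exp (3 * C) / s ^ 2 := by
  have hs0 : 0 < s := by linarith
  have hl : 0 ≤ Real.log ‖z‖ := Real.log_nonneg (by linarith)
  rw [abs_le] at hu hv
  have h1 : 2 * u z - v z ≤ 3 * C - 2 * Real.log ‖z‖ := by
    have := mul_nonneg (show 0 ≤ 2 * γ - γ' - 1 by linarith) hl
    linarith [hu.2, hv.1]
  have h2 : Real.log s ≤ Real.log ‖z‖ := Real.log_le_log hs0 hz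
  have h3 : Real.exp (3 * C) / s ^ 2 = Real.exp (3 * C - 2 * Real.log s) := by
    rw [Real.exp_sub, two_mul (Real.log s), Real.exp_add, Real.exp_log hs0, sq]
  rw [h3]
  exact Real.exp_le_exp.2 (by linarith)

/-- Growth of the coefficients of the Toda operator at infinity. -/
theorem exists_norm_W_le_at_infinity (h : ClassicalSolution {0, 1}ᶜ u v) {γ γ' : ℝ}
    (hγ : 1 < 2 * γ - γ') (hγ' : 1 < 2 * γ' - γ) (hu : LogAsymptoticAtInfinity γ u)
    (hv : LogAsymptoticAtInfinity γ' v) :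
    ∃ K ρ : ℝ, ∀ z m, 0 < m → ‖z‖ = m ^ 4 → ρ < m →
      ‖W2 u v z‖ ≤ K / m ^ 6 ∧ ‖W3 u v z‖ ≤ K / m ^ 9 := by
  obtain ⟨C₁, R₁, hC₁, hb₁⟩ := exists_log_bound_at_infinity hu
  obtain ⟨C₂, R₂, hC₂, hb₂⟩ := exists_log_bound_at_infinity hv
  set C := max C₁ C₂ with hC
  have hC0 : 0 < C := lt_max_of_lt_left hC₁
  set K := 8 * (|γ| + |γ'|) + C + Real.exp (3 * C) + 1 with hK
  have hK0 : 0 < K := by positivity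
  refine ⟨6000 * (2 * K) ^ 2 + 400000 * (2 * K) ^ 3, max 2 (2 * max R₁ R₂), ?_⟩
  intro z m hm hzm hmρ
  have hm2 : 2 < m := (le_max_left _ _).trans_lt hmρ
  have hmR : 2 * max R₁ R₂ < m := (le_max_right _ _).trans_lt hmρ
  have hm4 : m ≤ m ^ 4 := le_self_pow₀ (by linarith) (by norm_num)
  have hm16 : 16 < m ^ 4 := by
    have := pow_lt_pow_left₀ hm2 (by norm_num) (n := 4) (by norm_num)
    linarith
  have hs : 0 < m ^ 4 / 2 := by positivity
  have hdist : ∀ w ∈ ball z (m ^ 4 / 2), m ^ 4 / 2 ≤ ‖w‖ ∧ ‖w‖ ≤ 2 * m ^ 4 := by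
    intro w hw
    rw [mem_ball] at hw
    rw [← dist_zero_right] at hzm ⊢
    have h1 := dist_triangle w z 0
    have h2 := dist_triangle z w 0
    rw [dist_comm z w] at h2
    constructor <;> linarith
  have hsub : ball z (m ^ 4 / 2) ⊆ {0, 1}ᶜ := by
    intro w hw
    have := (hdist w hw).1
    simp only [mem_compl_iff, mem_insert_iff, mem_singleton_iff, not_or]
    constructor <;> rintro rfl <;> simp at this <;> linarith
  have hR : ∀ w ∈ ball z (m ^ 4 / 2), R₁ ≤ ‖w‖ ∧ R₂ ≤ ‖w‖ := by
    intro w hw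
    have := (hdist w hw).1
    have := le_max_left R₁ R₂
    have := le_max_right R₁ R₂
    constructor <;> linarith
  have hu1 : ∀ w ∈ ball z (m ^ 4 / 2), |u w - (-2 * γ * Real.log ‖w‖)| ≤ C := fun w hw =>
    (hb₁ w (hR w hw).1).trans (le_max_left _ _)
  have hv1 : ∀ w ∈ ball z (m ^ 4 / 2), |v w - (-2 * γ' * Real.log ‖w‖)| ≤ C := fun w hw =>
    (hb₂ w (hR w hw).2).trans (le_max_right _ _)
  have hlog : ∀ w ∈ ball z (m ^ 4 / 2), |Real.log ‖w‖| ≤ 4 * m := by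
    intro w hw
    have h1 := hdist w hw
    rw [abs_of_nonneg (Real.log_nonneg (by linarith))]
    have h2 := Real.log_le_log (by linarith) h1.2
    rw [Real.log_mul (by norm_num) (by positivity), Real.log_pow] at h2
    have h3 := Real.log_le_sub_one_of_pos hm
    have h4 := Real.log_two_lt_d9
    push_cast at h2
    linarith
  have hgrow : ∀ (f : ℂ → ℝ) (g : ℝ), |g| ≤ |γ| + |γ'| → ∀ w ∈ ball z (m ^ 4 / 2),
      |f w - (-2 * g * Real.log ‖w‖)| ≤ C → |f w| ≤ K * m := by
    intro f g hg w hw hf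
    have h1 : |f w| ≤ |f w - (-2 * g * Real.log ‖w‖)| + |-2 * g * Real.log ‖w‖| := by
      have := abs_add_le (f w - (-2 * g * Real.log ‖w‖)) (-2 * g * Real.log ‖w‖)
      rwa [sub_add_cancel] at this
    have h2 : |-2 * g * Real.log ‖w‖| ≤ 8 * (|γ| + |γ'|) * m := by
      rw [abs_mul, abs_mul]
      calc |(-2 : ℝ)| * |g| * |Real.log ‖w‖| ≤ 2 * (|γ| + |γ'|) * (4 * m) := by
            gcongr
            · norm_num
            · exact hlog w hw
        _ = 8 * (|γ| + |γ'|) * m := by ring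
    have h3 : C ≤ C * m := by nlinarith
    have h4 : 0 < (Real.exp (3 * C) + 1) * m := by positivity
    rw [hK]
    linarith
  have hK1 : 1 ≤ K := by
    have : 0 ≤ 8 * (|γ| + |γ'|) + C + Real.exp (3 * C) := by positivity
    linarith
  have hexpK : Real.exp (3 * C) ≤ K * m := by
    have h1 : 0 ≤ 8 * (|γ| + |γ'|) + C + 1 := by positivity
    have h2 : Real.exp (3 * C) ≤ K := by linarith
    nlinarith
  -- At infinity logarithms are at most `4 m`, so `μ = K m` and `μ / s = 2K / m ^ 3`, whose square
  -- and cube are the exponents 6 and 9.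
  have hbound := (h.mono (isOpen_ball (x := z) (ε := m ^ 4 / 2)) hsub).norm_W_le hs
    (show 1 ≤ K * m by nlinarith)
    (fun w hw => hgrow u γ (by linarith [abs_nonneg γ']) w hw (hu1 w hw))
    (fun w hw => hgrow v γ' (by linarith [abs_nonneg γ]) w hw (hv1 w hw))
    (fun w hw => (exp_le_at_infinity hγ (by linarith) (hdist w hw).1 (hu1 w hw)
      (hv1 w hw)).trans (by gcongr))
    (fun w hw => (exp_le_at_infinity hγ' (by linarith) (hdist w hw).1 (hv1 w hw)
      (hu1 w hw)).trans (by gcongr))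
  constructor
  · refine hbound.1.trans ?_
    have : 6000 * (K * m / (m ^ 4 / 2)) ^ 2 = 6000 * (2 * K) ^ 2 / m ^ 6 := by
      field_simp
    rw [this]
    gcongr
    linarith [show 0 < 400000 * (2 * K) ^ 3 by positivity]
  · refine hbound.2.trans ?_
    have : 400000 * (K * m / (m ^ 4 / 2)) ^ 3 = 400000 * (2 * K) ^ 3 / m ^ 9 := by
      field_simp
    rw [this]
    gcongr
    linarith [show 0 < 6000 * (2 * K) ^ 2 by positivity]

end ClassicalSolution

/-! ### Specialisation to the punctured plane. -/

section Classical

variable {γu γv : Fin 3 → ℝ} {u v : ℂ → ℝ}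

theorem isOpen_compl_zero_one : IsOpen ({0, 1}ᶜ : Set ℂ) :=
  (Set.toFinite ({0, 1} : Set ℂ)).isClosed.isOpen_compl

theorem mem_compl_zero_one {z : ℂ} : z ∈ ({0, 1}ᶜ : Set ℂ) ↔ z ≠ 0 ∧ z ≠ 1 := by
  simp

theorem SolvesWithSources.weak_away {γ₀ γ₁ : ℝ} {u h : ℂ → ℝ} (hs : SolvesWithSources γ₀ γ₁ u h)
    {φ : ℂ → ℝ} (hφ : ContDiff ℝ ∞ φ) (hc : HasCompactSupport φ) (hU : tsupport φ ⊆ {0, 1}ᶜ) :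
    (∫ z, u z * (Δ φ) z) + (∫ z, 4 * Real.exp (h z) * φ z) = 0 := by
  have h0 : φ 0 = 0 := image_eq_zero_of_notMem_tsupport fun h => by simpa using hU h
  have h1 : φ 1 = 0 := image_eq_zero_of_notMem_tsupport fun h => by simpa using hU h
  rw [hs.weak_eq φ hφ hc, h0, h1]
  ring

/-- The open unit disc about one source does not contain the other, whose term therefore drops out.
-/
theorem SolvesWithSources.weakNear_zero {γ₀ γ₁ : ℝ} {u h : ℂ → ℝ}
    (hs : SolvesWithSources γ₀ γ₁ u h) : ClassicalSolution.WeakNear 0 γ₀ u h := by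
  intro φ hφ hc hU
  have h1 : φ 1 = 0 := image_eq_zero_of_notMem_tsupport fun h => by simpa using hU h
  rw [hs.weak_eq φ hφ hc, h1]
  ring

theorem SolvesWithSources.weakNear_one {γ₀ γ₁ : ℝ} {u h : ℂ → ℝ}
    (hs : SolvesWithSources γ₀ γ₁ u h) : ClassicalSolution.WeakNear 1 γ₁ u h := by
  intro φ hφ hc hU
  have h1 : φ 0 = 0 := image_eq_zero_of_notMem_tsupport fun h => by simpa using hU h
  rw [hs.weak_eq φ hφ hc, h1]
  ring

theorem IsSolution.classical (h : IsSolution γu γv u v) : ClassicalSolution {0, 1}ᶜ u v where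
  isOpen := isOpen_compl_zero_one
  smooth_u := h.smooth_u
  smooth_v := h.smooth_v
  eq_u _ hz := laplacian_eq_of_weak isOpen_compl_zero_one h.smooth_u
    ((contDiffOn_const.mul h.smooth_u).sub h.smooth_v) (fun _ => h.eq_u.weak_away) hz
  eq_v _ hz := laplacian_eq_of_weak isOpen_compl_zero_one h.smooth_v
    ((contDiffOn_const.mul h.smooth_v).sub h.smooth_u) (fun _ => h.eq_v.weak_away) hz

theorem punctured_ball_subset {p : ℂ} (hp : p = 0 ∨ p = 1) : ball p 1 \ {p} ⊆ {0, 1}ᶜ := by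
  rintro z ⟨hz, hzp⟩
  rw [mem_compl_zero_one]
  rcases hp with rfl | rfl
  · exact ⟨hzp, by rintro rfl; simp at hz⟩
  · exact ⟨by rintro rfl; simp at hz, hzp⟩

theorem IsSolution.exists_norm_W_le_near (h : IsSolution γu γv u v) {p : ℂ} (hp : p = 0 ∨ p = 1) :
    ∃ K ρ : ℝ, 0 < ρ ∧ ∀ z m, 0 < m → ‖z - p‖ = m ^ 4 → m < ρ →
      ‖W2 u v z‖ ≤ K / m ^ 10 ∧ ‖W3 u v z‖ ≤ K / m ^ 15 := by
  have hc := h.classical.mono (isOpen_ball.sdiff isClosed_singleton) (punctured_ball_subset hp)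
  rcases hp with rfl | rfl
  · exact hc.exists_norm_W_le_near h.eq_u.locallyIntegrable h.eq_v.locallyIntegrable
      h.eq_u.locallyIntegrable_exp h.eq_v.locallyIntegrable_exp h.eq_u.weakNear_zero
      h.eq_v.weakNear_zero
  · exact hc.exists_norm_W_le_near h.eq_u.locallyIntegrable h.eq_v.locallyIntegrable
      h.eq_u.locallyIntegrable_exp h.eq_v.locallyIntegrable_exp h.eq_u.weakNear_one
      h.eq_v.weakNear_one

end Classical

/-! ### From growth bounds to polynomials. -/

section Asymptotics

theorem exists_pow_four_eq {r : ℝ} (hr : 0 < r) : ∃ m, 0 < m ∧ r = m ^ 4 := by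
  refine ⟨Real.sqrt (Real.sqrt r), by positivity, ?_⟩
  rw [show (4 : ℕ) = 2 * 2 from rfl, pow_mul, Real.sq_sqrt (Real.sqrt_nonneg _), Real.sq_sqrt hr.le]

theorem isLittleO_inv_sub {f : ℂ → ℂ} {p : ℂ} {K ρ : ℝ} (hρ : 0 < ρ)
    (h : ∀ z m, 0 < m → ‖z - p‖ = m ^ 4 → m < ρ → ‖f z‖ * m ^ 4 ≤ K * m) :
    f =o[𝓝[≠] p] fun z => (z - p)⁻¹ := by
  rw [Asymptotics.isLittleO_iff]
  intro c hc
  set δ := min ρ (c / (|K| + 1)) with hδ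
  have hδ0 : 0 < δ := lt_min hρ (by positivity)
  filter_upwards [mem_nhdsWithin_of_mem_nhds (ball_mem_nhds p (show 0 < δ ^ 4 by positivity)),
    self_mem_nhdsWithin] with z hz hzp
  obtain ⟨m, hm, hzm⟩ := exists_pow_four_eq (norm_pos_iff.2 (sub_ne_zero.2 hzp))
  rw [mem_ball, dist_eq_norm, hzm] at hz
  have hmδ : m < δ := lt_of_pow_lt_pow_left₀ 4 hδ0.le hz
  have h1 := h z m hm hzm (hmδ.trans_le (min_le_left _ _))
  rw [norm_inv, hzm, ← div_eq_mul_inv, le_div_iff₀ (by positivity)]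
  refine h1.trans ?_
  have h2 : m ≤ c / (|K| + 1) := hmδ.le.trans (min_le_right _ _)
  rw [le_div_iff₀ (by positivity)] at h2
  nlinarith [le_abs_self K]

theorem isLittleO_pow_cobounded {f : ℂ → ℂ} {n : ℕ} {K ρ : ℝ}
    (h : ∀ z m, 0 < m → ‖z‖ = m ^ 4 → ρ < m → ‖f z‖ * m ≤ K * (m ^ 4) ^ n) :
    f =o[Bornology.cobounded ℂ] fun z => z ^ n := by
  rw [Asymptotics.isLittleO_iff]
  intro c hc
  set B := max (max ρ 1) (|K| / c) with hB
  have hB1 : 1 ≤ B := (le_max_right _ _).trans (le_max_left _ _)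
  rw [← comap_norm_atTop, eventually_comap]
  filter_upwards [eventually_gt_atTop (B ^ 4)] with R hR z hz
  have hR0 : 0 < R := (show 0 < B ^ 4 by positivity).trans hR
  obtain ⟨m, hm, hzm⟩ := exists_pow_four_eq hR0
  rw [hzm] at hR
  have hBm : B < m := lt_of_pow_lt_pow_left₀ 4 hm.le hR
  have h1 := h z m hm (hz.trans hzm) (((le_max_left _ _).trans (le_max_left _ _)).trans_lt hBm)
  have h2 : |K| / c ≤ m := (le_max_right _ _).trans hBm.le
  rw [div_le_iff₀ hc] at h2
  rw [norm_pow, hz, hzm]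
  refine le_of_mul_le_mul_right (h1.trans ?_) hm
  have h3 : 0 ≤ (m ^ 4) ^ n := by positivity
  have h4 := mul_le_mul_of_nonneg_right ((le_abs_self K).trans h2) h3
  linarith

theorem norm_mul_sub_one_le {z : ℂ} {p : ℂ} (hp : p = 0 ∨ p = 1) (hz : ‖z - p‖ ≤ 1) :
    ‖z * (z - 1)‖ ≤ 2 * ‖z - p‖ := by
  rw [norm_mul]
  rcases hp with rfl | rfl
  · rw [sub_zero] at *
    have := norm_sub_le z 1
    rw [norm_one] at this
    nlinarith [norm_nonneg z]
  · have := norm_add_le (z - 1) 1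
    rw [norm_one, sub_add_cancel] at this
    nlinarith [norm_nonneg (z - 1)]

theorem norm_mul_sub_one_le_of_one_le {z : ℂ} (hz : 1 ≤ ‖z‖) : ‖z * (z - 1)‖ ≤ 2 * ‖z‖ ^ 2 := by
  rw [norm_mul]
  have := norm_sub_le z 1
  rw [norm_one] at this
  nlinarith

/-- A function holomorphic off `0` and `1` with nearly poles of order `k` at `0`, `1` and a zero
of nearly order `k` at infinity becomes a polynomial of degree `≤ k` after clearing denominators. -/
theorem exists_sum_eq {W : ℂ → ℂ} {k a b : ℕ} (hW : DifferentiableOn ℂ W {0, 1}ᶜ)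
    (hk : a + 1 ≤ 4 * k + 4) (hb : 4 * k + 1 ≤ b + 4)
    (hnear : ∀ p : ℂ, p = 0 ∨ p = 1 → ∃ K ρ : ℝ, 0 < ρ ∧ ∀ z m, 0 < m → ‖z - p‖ = m ^ 4 → m < ρ →
      ‖W z‖ ≤ K / m ^ a)
    (hinf : ∃ K ρ : ℝ, ∀ z m, 0 < m → ‖z‖ = m ^ 4 → ρ < m → ‖W z‖ ≤ K / m ^ b) :
    ∃ c : ℕ → ℂ, ∀ z ∈ ({0, 1}ᶜ : Set ℂ),
      (z * (z - 1)) ^ k * W z = ∑ j ∈ Finset.range (k + 1), c j * z ^ j := by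
  -- In powers of `m`: near a source `|f| m ^ 4` is of order `m ^ (4k + 4 - a)`, and `hk` leaves one
  -- factor `m` to spare, so the singularity is removable. At infinity `|f| m` is of order `m ^ (8k
  -- + 1 - b)`, which `hb` bounds by `m ^ (4 (k + 1))`, so `f` is `o(z ^ (k + 1))`.
  set f : ℂ → ℂ := fun z => (z * (z - 1)) ^ k * W z with hf
  have hfd : DifferentiableOn ℂ f {0, 1}ᶜ :=
    DifferentiableOn.mul (Differentiable.differentiableOn (by fun_prop)) hW
  have ho : ∀ p : ℂ, p = 0 ∨ p = 1 → f =o[𝓝[≠] p] fun z => (z - p)⁻¹ := by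
    intro p hp
    obtain ⟨K, ρ, hρ, hK⟩ := hnear p hp
    refine isLittleO_inv_sub (K := 2 ^ k * K) (lt_min hρ one_pos) fun z m hm hzm hmρ => ?_
    have hm1 : m < 1 := hmρ.trans_le (min_le_right _ _)
    have h1 := hK z m hm hzm (hmρ.trans_le (min_le_left _ _))
    have hK0 : 0 ≤ K := by
      have := (norm_nonneg _).trans h1
      rwa [le_div_iff₀ (by positivity), zero_mul] at this
    have h2 := norm_mul_sub_one_le hp (z := z) (by
      rw [hzm]; exact pow_le_one₀ hm.le hm1.le)
    rw [hzm] at h2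
    calc ‖f z‖ * m ^ 4 ≤ (2 * m ^ 4) ^ k * (K / m ^ a) * m ^ 4 := by
          simp only [hf]
          rw [norm_mul, norm_pow]
          gcongr
      _ = 2 ^ k * K * (m ^ (4 * k + 4) / m ^ a) := by
          rw [mul_pow, ← pow_mul, pow_add]; ring
      _ ≤ 2 ^ k * K * m := by
          gcongr
          rw [div_le_iff₀ (by positivity), ← pow_succ']
          exact pow_le_pow_of_le_one hm.le hm1.le hk
  obtain ⟨G, hG, hGf⟩ := exists_differentiable_eqOn hfd (ho 0 (Or.inl rfl)) (ho 1 (Or.inr rfl))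
  obtain ⟨K, ρ, hK⟩ := hinf
  have hGO : G =o[Bornology.cobounded ℂ] fun z => z ^ (k + 1) := by
    refine isLittleO_pow_cobounded (K := 2 ^ k * K) (ρ := max ρ 1) fun z m hm hzm hmρ => ?_
    have hm1 : 1 < m := (le_max_right _ _).trans_lt hmρ
    have hz1 : 1 < ‖z‖ := by rw [hzm]; exact one_lt_pow₀ hm1 (by norm_num)
    have h1 := hK z m hm hzm ((le_max_left _ _).trans_lt hmρ)
    have hK0 : 0 ≤ K := by
      have := (norm_nonneg _).trans h1
      rwa [le_div_iff₀ (by positivity), zero_mul] at this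
    have h2 := norm_mul_sub_one_le_of_one_le hz1.le
    rw [hzm] at h2
    rw [hGf (mem_compl_zero_one.2 ⟨by rintro rfl; simp at hz1; linarith, by
      rintro rfl; simp at hz1⟩)]
    calc ‖f z‖ * m ≤ (2 * (m ^ 4) ^ 2) ^ k * (K / m ^ b) * m := by
          simp only [hf]
          rw [norm_mul, norm_pow]
          gcongr
      _ = 2 ^ k * K * (m ^ (8 * k + 1) / m ^ b) := by
          rw [mul_pow, ← pow_mul, ← pow_mul, pow_succ m (8 * k)]; ring
      _ ≤ 2 ^ k * K * (m ^ 4) ^ (k + 1) := by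
          gcongr
          rw [div_le_iff₀ (by positivity), ← pow_mul, ← pow_add]
          exact pow_le_pow_right₀ hm1.le (by omega)
  obtain ⟨c, hc⟩ := exists_eq_sum_of_isLittleO hG hGO
  exact ⟨c, fun z hz => by rw [← hc, hGf hz]⟩

end Asymptotics

/-! ### Existence and uniqueness of the constants. -/

section CoefficientAlgebra

/-- The coefficient `W₂` determined by the constants. -/
noncomputable def Coefficients.w2 (c : Coefficients) (z : ℂ) : ℂ :=
  c.A / z ^ 2 + c.B / (z * (z - 1)) + c.C / (z - 1) ^ 2

/-- The coefficient `W₃` determined by the constants. -/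
noncomputable def Coefficients.w3 (c : Coefficients) (z : ℂ) : ℂ :=
  c.D / z ^ 3 + c.E / (z ^ 2 * (z - 1)) + c.F / (z * (z - 1) ^ 2) + c.G / (z - 1) ^ 3

variable {u v : ℂ → ℝ}

theorem dz_const (a z : ℂ) : dz (fun _ => a) z = 0 := by
  simp [dz]

theorem dz_id (z : ℂ) : dz (fun z => z) z = 1 := by
  simp [dz]
  norm_num

/-- The coefficients are read off from two test functions: `y = 1` gives `W3`, and `y = z` gives `W2
+ z W3`. -/
theorem Coefficients.represents_iff (h : ClassicalSolution {0, 1}ᶜ u v) (c : Coefficients) :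
    c.Represents u v ↔ ∀ z ∈ ({0, 1}ᶜ : Set ℂ), W2 u v z = c.w2 z ∧ W3 u v z = c.w3 z := by
  have hdz0 : dz (fun _ => (0 : ℂ)) = fun _ => 0 := funext fun z => dz_const 0 z
  have hdz1 : dz (fun _ => (1 : ℂ)) = fun _ => 0 := funext fun z => dz_const 1 z
  have hdzi : dz (fun z : ℂ => z) = fun _ => 1 := funext dz_id
  constructor
  · intro hc z hz
    obtain ⟨hz0, hz1⟩ := mem_compl_zero_one.1 hz
    have e1 := hc (fun _ => 1) contDiffOn_const z hz0 hz1
    have e2 := hc (fun z => z) contDiffOn_id z hz0 hz1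
    rw [h.todaOperator_eq contDiffOn_const hz, Coefficients.operator, hdz1, hdz0, hdz0] at e1
    rw [h.todaOperator_eq (y := fun z => z) contDiffOn_id hz, Coefficients.operator] at e2
    simp only [hdzi, hdz1, hdz0] at e2
    have e3 : W3 u v z = c.w3 z := by
      rw [Coefficients.w3]; linear_combination e1
    refine ⟨?_, e3⟩
    rw [Coefficients.w3] at e3
    rw [Coefficients.w2]
    linear_combination e2 - z * e3
  · intro hc y hy z hz0 hz1
    have hz := mem_compl_zero_one.2 ⟨hz0, hz1⟩
    rw [h.todaOperator_eq hy hz, (hc z hz).1, (hc z hz).2]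
    rfl

theorem Coefficients.mul_w2 (c : Coefficients) {z : ℂ} (hz : z ∈ ({0, 1}ᶜ : Set ℂ)) :
    (z * (z - 1)) ^ 2 * c.w2 z = c.A * (z - 1) ^ 2 + c.B * (z * (z - 1)) + c.C * z ^ 2 := by
  obtain ⟨hz0, hz1⟩ := mem_compl_zero_one.1 hz
  have := sub_ne_zero.2 hz1
  rw [Coefficients.w2]
  field_simp

theorem Coefficients.mul_w3 (c : Coefficients) {z : ℂ} (hz : z ∈ ({0, 1}ᶜ : Set ℂ)) :
    (z * (z - 1)) ^ 3 * c.w3 z = c.D * (z - 1) ^ 3 + c.E * (z * (z - 1) ^ 2) +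
      c.F * (z ^ 2 * (z - 1)) + c.G * z ^ 3 := by
  obtain ⟨hz0, hz1⟩ := mem_compl_zero_one.1 hz
  have := sub_ne_zero.2 hz1
  rw [Coefficients.w3]
  field_simp

theorem mul_sub_one_ne_zero {z : ℂ} (hz : z ∈ ({0, 1}ᶜ : Set ℂ)) : z * (z - 1) ≠ 0 := by
  obtain ⟨hz0, hz1⟩ := mem_compl_zero_one.1 hz
  exact mul_ne_zero hz0 (sub_ne_zero.2 hz1)

/-- After clearing denominators both sides are polynomials of degree at most 2 and 3, written in the
bases `z ^ j (z - 1) ^ (k - j)`; three and four evaluation points determine them. -/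
theorem Coefficients.eq_of_w_eq {c c' : Coefficients}
    (h : ∀ z ∈ ({0, 1}ᶜ : Set ℂ), c.w2 z = c'.w2 z ∧ c.w3 z = c'.w3 z) : c = c' := by
  have h2 : ∀ z ∈ ({0, 1}ᶜ : Set ℂ), c.A * (z - 1) ^ 2 + c.B * (z * (z - 1)) + c.C * z ^ 2 =
      c'.A * (z - 1) ^ 2 + c'.B * (z * (z - 1)) + c'.C * z ^ 2 := fun z hz => by
    rw [← c.mul_w2 hz, ← c'.mul_w2 hz, (h z hz).1]
  have h3 : ∀ z ∈ ({0, 1}ᶜ : Set ℂ), c.D * (z - 1) ^ 3 + c.E * (z * (z - 1) ^ 2) +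
      c.F * (z ^ 2 * (z - 1)) + c.G * z ^ 3 = c'.D * (z - 1) ^ 3 + c'.E * (z * (z - 1) ^ 2) +
      c'.F * (z ^ 2 * (z - 1)) + c'.G * z ^ 3 := fun z hz => by
    rw [← c.mul_w3 hz, ← c'.mul_w3 hz, (h z hz).2]
  have m2 : (2 : ℂ) ∈ ({0, 1}ᶜ : Set ℂ) := mem_compl_zero_one.2 (by norm_num)
  have m3 : (3 : ℂ) ∈ ({0, 1}ᶜ : Set ℂ) := mem_compl_zero_one.2 (by norm_num)
  have mn : (-1 : ℂ) ∈ ({0, 1}ᶜ : Set ℂ) := mem_compl_zero_one.2 (by norm_num)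
  have mh : (1 / 2 : ℂ) ∈ ({0, 1}ᶜ : Set ℂ) := mem_compl_zero_one.2 (by norm_num)
  have a1 := h2 _ m2
  have a2 := h2 _ mn
  have a3 := h2 _ mh
  have b1 := h3 _ m2
  have b2 := h3 _ mn
  have b3 := h3 _ mh
  have b4 := h3 _ m3
  obtain ⟨A, B, C, D, E, F, G⟩ := c
  obtain ⟨A', B', C', D', E', F', G'⟩ := c'
  simp only at a1 a2 a3 b1 b2 b3 b4
  simp only [Coefficients.mk.injEq]
  refine ⟨?_, ?_, ?_, ?_, ?_, ?_, ?_⟩ <;> grind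

theorem exists_coefficients (h2 : ∃ c : ℕ → ℂ, ∀ z ∈ ({0, 1}ᶜ : Set ℂ),
      (z * (z - 1)) ^ 2 * W2 u v z = ∑ j ∈ Finset.range (2 + 1), c j * z ^ j)
    (h3 : ∃ c : ℕ → ℂ, ∀ z ∈ ({0, 1}ᶜ : Set ℂ),
      (z * (z - 1)) ^ 3 * W3 u v z = ∑ j ∈ Finset.range (3 + 1), c j * z ^ j) :
    ∃ c : Coefficients, ∀ z ∈ ({0, 1}ᶜ : Set ℂ), W2 u v z = c.w2 z ∧ W3 u v z = c.w3 z := by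
  obtain ⟨p, hp⟩ := h2
  obtain ⟨q, hq⟩ := h3
  -- The change of basis from monomials to `z ^ j (z - 1) ^ (k - j)`. The values at `0` give `A` and
  -- `-D`, the values at `1` give `C` and `G`.
  refine ⟨⟨p 0, -p 1 - 2 * p 0, p 2 + p 1 + p 0, -q 0, q 1 + 3 * q 0,
    -q 2 - 2 * q 1 - 3 * q 0, q 3 + q 2 + q 1 + q 0⟩, fun z hz => ⟨?_, ?_⟩⟩
  · refine mul_left_cancel₀ (pow_ne_zero 2 (mul_sub_one_ne_zero hz)) ?_
    rw [hp z hz, Coefficients.mul_w2 _ hz]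
    simp only [Finset.sum_range_succ, Finset.sum_range_zero]
    ring
  · refine mul_left_cancel₀ (pow_ne_zero 3 (mul_sub_one_ne_zero hz)) ?_
    rw [hq z hz, Coefficients.mul_w3 _ hz]
    simp only [Finset.sum_range_succ, Finset.sum_range_zero]
    ring

end CoefficientAlgebra

/-! ### Reflection symmetry. -/

section Symmetry

open ComplexConjugate

variable {u v : ℂ → ℝ} {f : ℂ → ℂ} {z : ℂ}

theorem conj_mem_compl_zero_one {z : ℂ} (hz : z ∈ ({0, 1}ᶜ : Set ℂ)) :
    conj z ∈ ({0, 1}ᶜ : Set ℂ) := by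
  obtain ⟨hz0, hz1⟩ := mem_compl_zero_one.1 hz
  refine mem_compl_zero_one.2 ⟨by simpa using hz0, fun h => hz1 ?_⟩
  rw [← Complex.conj_conj z, h, map_one]

/-- Differentiate `f = conj ∘ f ∘ conj` by the chain rule: reflection reverses the imaginary
direction, hence the sign in front of `β`. For `∂_z` and `∂_z̄` the coefficients `conj α`, `-conj β`
are again `α`, `β`. -/
theorem wirt_conj (hf : ContDiffOn ℝ ∞ f {0, 1}ᶜ)
    (hsym : ∀ w ∈ ({0, 1}ᶜ : Set ℂ), f (conj w) = conj (f w)) (hz : z ∈ ({0, 1}ᶜ : Set ℂ))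
    (α β : ℂ) : wirt α β f (conj z) = conj (wirt (conj α) (-conj β) f z) := by
  have e : EqOn f (fun w => conj (f (conj w))) {0, 1}ᶜ := fun w hw => by
    simp only [hsym w hw, Complex.conj_conj]
  have hd := (hf.diffAt isOpen_compl_zero_one (conj_mem_compl_zero_one hz)).hasFDerivAt
  have hc : ∀ w, HasFDerivAt (fun w : ℂ => conj w) (Complex.conjCLE : ℂ →L[ℝ] ℂ) w := fun w =>
    Complex.conjCLE.hasFDerivAt
  have h1 := ((hc (f (conj z))).comp z (hd.comp z (hc z))).fderiv
  have h2 : ∀ w, pd w f z = conj (pd (conj w) f (conj z)) := fun w => by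
    rw [pd_congr isOpen_compl_zero_one e w hz]
    simp only [pd]
    simp only [Function.comp_def] at h1
    rw [h1]
    simp
  have h3 := h2 1
  have h4 := h2 Complex.I
  simp only [map_one, Complex.conj_I] at h3 h4
  have h5 : pd (-Complex.I) f (conj z) = -pd Complex.I f (conj z) := by simp [pd]
  rw [h5] at h4
  simp only [wirt, h3, h4]
  simp

theorem dz_conj (hf : ContDiffOn ℝ ∞ f {0, 1}ᶜ)
    (hsym : ∀ w ∈ ({0, 1}ᶜ : Set ℂ), f (conj w) = conj (f w)) (hz : z ∈ ({0, 1}ᶜ : Set ℂ)) :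
    dz f (conj z) = conj (dz f z) := by
  rw [dz_eq_wirt, wirt_conj hf hsym hz]
  congr 2 <;> simp [Complex.conj_ofNat, neg_div]

theorem dzbar_conj (hf : ContDiffOn ℝ ∞ f {0, 1}ᶜ)
    (hsym : ∀ w ∈ ({0, 1}ᶜ : Set ℂ), f (conj w) = conj (f w)) (hz : z ∈ ({0, 1}ᶜ : Set ℂ)) :
    dzbar f (conj z) = conj (dzbar f z) := by
  rw [dzbar, wirt_conj hf hsym hz]
  congr 2 <;> simp [Complex.conj_ofNat, neg_div]

namespace ClassicalSolution

theorem dzReal_conj (h : ClassicalSolution {0, 1}ᶜ u v)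
    (hsym : ∀ w ∈ ({0, 1}ᶜ : Set ℂ), u (conj w) = u w) (hz : z ∈ ({0, 1}ᶜ : Set ℂ)) :
    dzReal u (conj z) = conj (dzReal u z) :=
  dz_conj h.smooth_ofReal (fun w hw => by rw [hsym w hw, Complex.conj_ofReal]) hz

/-- The equation for `u` transfers the symmetry of `u` to `v`. -/
theorem symm_of_symm (h : ClassicalSolution {0, 1}ᶜ u v)
    (hsym : ∀ w ∈ ({0, 1}ᶜ : Set ℂ), u (conj w) = u w) (hz : z ∈ ({0, 1}ᶜ : Set ℂ)) :
    v (conj z) = v z := by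
  -- The quantity `∂_z̄ u_z = -exp (2u - v)` is reflection-symmetric, so `2u - v` is, and therefore
  -- `v`.
  have h1 := dzbar_conj h.smooth_dzReal (fun w hw => h.dzReal_conj hsym hw) hz
  rw [h.dzbar_dzReal hz, h.dzbar_dzReal (conj_mem_compl_zero_one hz), map_neg, neg_inj, expC, expC,
    Complex.conj_ofReal, Complex.ofReal_inj, Real.exp_eq_exp, hsym z hz] at h1
  linarith

theorem potX_conj (h : ClassicalSolution {0, 1}ᶜ u v)
    (hu : ∀ w ∈ ({0, 1}ᶜ : Set ℂ), u (conj w) = u w)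
    (hv : ∀ w ∈ ({0, 1}ᶜ : Set ℂ), v (conj w) = v w) (hz : z ∈ ({0, 1}ᶜ : Set ℂ)) :
    potX u v (conj z) = conj (potX u v z) := by
  simp only [potX, map_sub, map_add, map_mul]
  rw [dz_conj h.smooth_dzReal (fun w hw => h.dzReal_conj hu hw) hz, h.dzReal_conj hu hz,
    h.symm.dzReal_conj hv hz]

theorem W2_conj (h : ClassicalSolution {0, 1}ᶜ u v)
    (hu : ∀ w ∈ ({0, 1}ᶜ : Set ℂ), u (conj w) = u w)
    (hv : ∀ w ∈ ({0, 1}ᶜ : Set ℂ), v (conj w) = v w) (hz : z ∈ ({0, 1}ᶜ : Set ℂ)) :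
    W2 u v (conj z) = conj (W2 u v z) := by
  simp only [W2, map_sub, map_add, map_mul]
  rw [dz_conj h.symm.smooth_dzReal (fun w hw => h.symm.dzReal_conj hv hw) hz,
    h.symm.dzReal_conj hv hz, h.potX_conj hu hv hz]

theorem W3_conj (h : ClassicalSolution {0, 1}ᶜ u v)
    (hu : ∀ w ∈ ({0, 1}ᶜ : Set ℂ), u (conj w) = u w)
    (hv : ∀ w ∈ ({0, 1}ᶜ : Set ℂ), v (conj w) = v w) (hz : z ∈ ({0, 1}ᶜ : Set ℂ)) :
    W3 u v (conj z) = conj (W3 u v z) := by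
  simp only [W3, map_sub, map_mul]
  rw [dz_conj h.smooth_potX (fun w hw => h.potX_conj hu hv hw) hz,
    h.symm.dzReal_conj hv hz, h.potX_conj hu hv hz]

end ClassicalSolution

/-- The complex conjugate constants. -/
noncomputable def Coefficients.conj (c : Coefficients) : Coefficients :=
  ⟨star c.A, star c.B, star c.C, star c.D, star c.E, star c.F, star c.G⟩

theorem Coefficients.w2_conj (c : Coefficients) (z : ℂ) : c.conj.w2 z = star (c.w2 (star z)) := by
  simp [Coefficients.w2, Coefficients.conj]

theorem Coefficients.w3_conj (c : Coefficients) (z : ℂ) : c.conj.w3 z = star (c.w3 (star z)) := by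
  simp [Coefficients.w3, Coefficients.conj]

end Symmetry

end SU3Toda

/-! ### The main theorem. -/

theorem mainTheorem6 (γu γv : Fin 3 → ℝ)
    (h0 : -1 < 2 * γu 0 - γv 0 ∧ -1 < 2 * γv 0 - γu 0)
    (h1 : -1 < 2 * γu 1 - γv 1 ∧ -1 < 2 * γv 1 - γu 1)
    (hinf : 1 < 2 * γu 2 - γv 2 ∧ 1 < 2 * γv 2 - γu 2)
    (u v : ℂ → ℝ) (huv : SU3Toda.IsSolution γu γv u v)
    (hsymm : ∀ x₁ x₂ : ℝ, u ⟨x₁, x₂⟩ = u ⟨x₁, -x₂⟩) :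
    (∃! c : SU3Toda.Coefficients, c.Represents u v) ∧
      ∀ c : SU3Toda.Coefficients, c.Represents u v → c.E.im = 0 ∧ c.F.im = 0 := by
  have hc := huv.classical
  have hu : ∀ w ∈ ({0, 1}ᶜ : Set ℂ), u (star w) = u w := fun w _ => (hsymm w.re w.im).symm
  have hv : ∀ w ∈ ({0, 1}ᶜ : Set ℂ), v (star w) = v w := fun w hw => hc.symm_of_symm hu hw
  obtain ⟨K, ρ, hK⟩ := hc.exists_norm_W_le_at_infinity hinf.1 hinf.2 huv.infinity_u huv.infinity_v
  obtain ⟨c, hcW⟩ := SU3Toda.exists_coefficients (u := u) (v := v)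
    -- The exponents of `m` in the growth bounds: 10 and 6 for `W2` with `k = 2`, then 15 and 9 for
    -- `W3` with `k = 3`.
    (SU3Toda.exists_sum_eq (a := 10) (b := 6) hc.differentiableOn_W2 (by norm_num) (by norm_num)
      (fun p hp => by
        obtain ⟨K, ρ, hρ, hK⟩ := huv.exists_norm_W_le_near hp
        exact ⟨K, ρ, hρ, fun z m hm hz hmρ => (hK z m hm hz hmρ).1⟩)
      ⟨K, ρ, fun z m hm hz hmρ => (hK z m hm hz hmρ).1⟩)
    (SU3Toda.exists_sum_eq (a := 15) (b := 9) hc.differentiableOn_W3 (by norm_num) (by norm_num)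
      (fun p hp => by
        obtain ⟨K, ρ, hρ, hK⟩ := huv.exists_norm_W_le_near hp
        exact ⟨K, ρ, hρ, fun z m hm hz hmρ => (hK z m hm hz hmρ).2⟩)
      ⟨K, ρ, fun z m hm hz hmρ => (hK z m hm hz hmρ).2⟩)
  have huniq : ∀ c c' : SU3Toda.Coefficients, c.Represents u v → c'.Represents u v → c = c' := by
    intro c c' h h'
    rw [SU3Toda.Coefficients.represents_iff hc] at h h'
    exact SU3Toda.Coefficients.eq_of_w_eq fun z hz =>
      ⟨(h z hz).1.symm.trans (h' z hz).1, (h z hz).2.symm.trans (h' z hz).2⟩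
  refine ⟨⟨c, (SU3Toda.Coefficients.represents_iff hc c).2 hcW, fun c' hc' => huniq c' c hc'
    ((SU3Toda.Coefficients.represents_iff hc c).2 hcW)⟩, fun c hcr => ?_⟩
  have hW := (SU3Toda.Coefficients.represents_iff hc c).1 hcr
  -- Symmetry makes the conjugate constants represent the same operator; uniqueness then forces
  -- every constant to equal its conjugate.
  have hconj : c.conj.Represents u v := by
    rw [SU3Toda.Coefficients.represents_iff hc]
    intro z hz
    have hz' := SU3Toda.conj_mem_compl_zero_one hz
    have e2 := hc.W2_conj hu hv hz'
    have e3 := hc.W3_conj hu hv hz'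
    rw [Complex.conj_conj] at e2 e3
    rw [SU3Toda.Coefficients.w2_conj, SU3Toda.Coefficients.w3_conj, e2, e3]
    exact ⟨congrArg star (hW _ hz').1, congrArg star (hW _ hz').2⟩
  have he := huniq _ _ hconj hcr
  exact ⟨Complex.conj_eq_iff_im.1 (congrArg SU3Toda.Coefficients.E he),
    Complex.conj_eq_iff_im.1 (congrArg SU3Toda.Coefficients.F he)⟩
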